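/- Let $K$ be a complete discretely valued field whose residue field is perfect of characteristic $p>0$, and let $L/K$ be a finite separable totally ramified extension of degree $n$; put $\nu=v_p(n)$. Let $\mathcal O_K,\mathcal O_L$ be the valuation rings, $v_L$ the valuation of $L$ normalized by $v_L(L^\times)=\mathbb Z$, and let $R\subset\mathcal O_K$ be the set of Teichmüller representatives of the residue field. *Indices of inseparability.* Choose uniformizers $\varpi_K,\varpi_L$ of $K,L$, and let $\sum_{h\ge0}a_hX^{h+n}$ be the unique series with coefficients $a_h\in R$ such that $\varpi_K=\sum_{h\ge 0}a_h\varpi_L^{h+n}$. For $0\le j\le\nu$ put $\tilde\imath_j=\min\{h\ge0: v_p(h+n)\le j,\ a_h\ne0\}$ (with $\tilde\imath_j=\infty$ if there is no such $h$), $i_\nu=\tilde\imath_\nu$, and $i_j=\min\{\tilde\imath_j,\ i_{j+1}+v_L(p)\}$ for $j=\nu-1,\dots,0$. The generalized Hasse–Herbrand functions are $$\phi^j_{L/K}(x)=\min\{\,i_{j_0}+p^{j_0}x : 0\le j_0\le j\,\}\qquad(x\ge 0).$$ *Copolygon.* Let $\pi_K,\pi_L$ be uniformizers of $K,L$ (not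 necessarily equal to $\varpi_K,\varpi_L$), let $F(X)\in X^n\mathcal O_K[[X]]$ be any series with $F(\pi_L)=\pi_K$, and let $$F^*(\epsilon)=\pi_K^{-1}\bigl(F(\pi_L+\pi_L\epsilon)-\pi_K\bigr)=c_1\epsilon+c_2\epsilon^2+\cdots\in\mathcal O_L[[\epsilon]].$$ For $0\le j\le\nu$ let $F^*(\epsilon_j)$ be the polynomial obtained from $F^*(\epsilon)$ by discarding all terms of degree $\ge p^{j+1}$. For a series $G=\sum_i g_i\epsilon^i$ over $\mathcal O_L$ put $\Psi^L_{G}(x)=\min\{v_L(g_i)+ix: i\ge1\}$, where $v_L(0)=\infty$. **Proposition.** For all $0\le j\le\nu$ and all real $x\ge0$, the value $\phi^j_{L/K}(x)$ is finite and $$\phi^j_{L/K}(x)=\Psi^L_{F^*(\epsilon_j)}(x).$$ -/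

import Mathlib

open IsLocalRing PowerSeries
open IsDiscreteValuationRing (addVal)
open scoped NNReal ENNReal PowerSeries

noncomputable section

namespace HasseHerbrand

/-- `y` is the sum of the series `∑ fᵢ sⁱ` in the `I`-adic topology of `S`. -/
def IsAdicSum {R S : Type*} [CommRing R] [CommRing S] [Algebra R S]
    (I : Ideal S) (f : R⟦X⟧) (s y : S) : Prop :=
  ∀ N : ℕ, ∃ M₀ : ℕ, ∀ M ≥ M₀,
    (∑ i ∈ Finset.range M, PowerSeries.coeff i f • s ^ i) - y ∈ I ^ N

/-- The value `f(s)`, the sum of `∑ fᵢ sⁱ` in the `I`-adic topology of `S` (it is unique if `S` is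
`I`-adically separated; an arbitrary element if the series diverges). -/
def adicEval {R S : Type*} [CommRing R] [CommRing S] [Algebra R S]
    (I : Ideal S) (f : R⟦X⟧) (s : S) : S :=
  Classical.epsilon (fun y => IsAdicSum I f s y)

/-- Here `A`, `B` are discrete valuation rings with fraction fields `K`, `L`, and `B` is an
`A`-algebra: `L / K` is totally ramified when the ramification index `v_L(π_K)` is `[L : K]`. -/
def IsTotallyRamified (A K B L : Type*) [CommRing A] [IsDomain A] [IsDiscreteValuationRing A]
    [Field K] [CommRing B] [IsDomain B] [IsDiscreteValuationRing B] [Field L]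
    [Algebra A B] [Algebra K L] : Prop :=
  ∀ π : A, Irreducible π → addVal B (algebraMap A B π) = (Module.finrank K L : ℕ∞)

section Indices

variable (p : ℕ) [Fact p.Prime]
  {A B : Type*} [CommRing A] [IsDomain A] [IsDiscreteValuationRing A]
  [IsAdicComplete (maximalIdeal A) A] [CharP (A ⧸ maximalIdeal A) p]
  [CommRing B] [IsDomain B] [IsDiscreteValuationRing B] [Algebra A B]

variable (A) in
/-- The set `R` of Teichmüller representatives. When the residue field `k` is perfect, the
perfection of `k` is `k` itself. -/
def teichmullerReps : Set A :=
  Set.range (Perfection.teichmuller₀ p (maximalIdeal A))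

/-- The series `∑_{h ≥ 0} a_h X^{h+n}` with coefficients `a_h ∈ R` whose value at `π_L` is `π_K`;
there is exactly one when `L / K` is totally ramified of degree `n`. -/
def teichmullerSeries (n : ℕ) (πK : A) (πL : B) : A⟦X⟧ :=
  Classical.epsilon (fun f : A⟦X⟧ =>
    (∀ i, PowerSeries.coeff i f ∈ teichmullerReps p A) ∧ (X : A⟦X⟧) ^ n ∣ f ∧
      IsAdicSum (maximalIdeal B) f πL (algebraMap A B πK))

/-- `ĩ_j = min {h ≥ 0 : v_p(h + n) ≤ j, a_h ≠ 0}`, and `∞` if there is no such `h`. -/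
def preIndex (n : ℕ) (πK : A) (πL : B) (j : ℕ) : ℕ∞ :=
  ⨅ (h : ℕ) (_ : padicValNat p (h + n) ≤ j ∧
    PowerSeries.coeff (h + n) (teichmullerSeries p n πK πL) ≠ 0), (h : ℕ∞)

/-- With `ν = v_p(n)`, this is the index of inseparability `i_{ν - k}`, by recursion on `k`. -/
def indexAux (n : ℕ) (πK : A) (πL : B) : ℕ → ℕ∞
  | 0 => preIndex p n πK πL (padicValNat p n)
  | k + 1 => min (preIndex p n πK πL (padicValNat p n - (k + 1)))
      (indexAux n πK πL k + addVal B (p : B))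

/-- The index of inseparability `i_j`, for `0 ≤ j ≤ ν = v_p(n)`:
`i_ν = ĩ_ν` and `i_j = min {ĩ_j, i_{j+1} + v_L(p)}` for `j < ν`. -/
def insepIndex (n : ℕ) (πK : A) (πL : B) (j : ℕ) : ℕ∞ :=
  indexAux p n πK πL (padicValNat p n - j)

/-- The generalized Hasse-Herbrand function `φ^j(x) = min {i_{j₀} + p^{j₀} x : 0 ≤ j₀ ≤ j}`. -/
def phi (n : ℕ) (πK : A) (πL : B) (j : ℕ) (x : ℝ≥0) : ℝ≥0∞ :=
  ⨅ j₀ ∈ Finset.range (j + 1),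
    ((insepIndex p n πK πL j₀ : ℝ≥0∞) + (p : ℝ≥0∞) ^ j₀ * (x : ℝ≥0∞))

end Indices

section Copolygon

variable {A B : Type*} [CommRing A] [CommRing B] [IsDomain B] [IsDiscreteValuationRing B]
  [Algebra A B]

/-- The series `F^*(ε) = π_K⁻¹ (F(π_L + π_L ε) - π_K)` in `B⟦ε⟧`. -/
def starSeries (πK : A) (πL : B) (F : A⟦X⟧) : B⟦X⟧ :=
  Classical.epsilon (fun G : B⟦X⟧ =>
    C (algebraMap A B πK) * G =
      adicEval ((maximalIdeal B).map (C : B →+* B⟦X⟧)) F (C πL + C πL * X)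
        - C (algebraMap A B πK))

/-- The valuation function `Ψ(x) = min {v_L(c_i) + i x : i ≥ 1}` of `∑ c_i ε^i`. -/
def Psi (G : B⟦X⟧) (x : ℝ≥0) : ℝ≥0∞ :=
  ⨅ (i : ℕ) (_ : 1 ≤ i),
    ((addVal B (PowerSeries.coeff i G) : ℝ≥0∞) + (i : ℝ≥0∞) * (x : ℝ≥0∞))

end Copolygon

end HasseHerbrand

end

/-! The proof makes the right-hand side independent of all choices and then computes it for one
convenient series.

Since `x ≥ 0`, a term of degree `i` is dominated by any term of degree `1 ≤ k ≤ i` with no larger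
valuation. So `Ψ` of a truncation depends only on the ideals generated by the coefficients of degree
at most `i`, which `CoeffDvd` compares. If `E` is the Eisenstein polynomial of `π_L`, Weierstrass
division gives `F - π_K = E * Q` with `Q(0)` a unit, so `π_K F^*(ε)` is a unit series times `E(π_L(1
+ ε))`. Another uniformizer changes this by a unit series and a substitution for `ε` without
constant term; neither changes the ideals (`HasRamification.coeffDvd_starSeries`).

One may therefore take for `F` the Teichmüller series, where `c_i = π_K⁻¹ ∑ a_m (m choose i) π_L^m`
and every nonzero `a_m` is a unit. From `m * choose (m-1) (i-1) = i * choose m i`, each term of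
`c_i` has valuation at least `i_s` with `s = v_p(i)` (`HasRamification.insepIndex_le_addVal`); as
`p^s ≤ i`, this gives `φ^j ≤ Ψ`. Conversely, either exactly one term of the coefficient of degree
`p^j` has valuation `i_j`, so that nothing cancels, or `i_s ≤ i_j` for some `s < j`; by induction
some `c_{p^s}` with `s ≤ j` has valuation at most `i_j`
(`HasRamification.exists_addVal_le_insepIndex`), which gives `Ψ ≤ φ^j`.

Finiteness means `i_0 < ∞`: this is clear if `p ≠ 0`, and follows from separability in
characteristic `p`. -/

namespace HasseHerbrand

/-! ### Ramification index and powers of a uniformizer as an integral basis. -/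

section Ramified

variable {A B : Type*} [CommRing A] [IsDomain A] [IsDiscreteValuationRing A]
  [CommRing B] [IsDomain B] [IsDiscreteValuationRing B] [Algebra A B]

theorem mem_maximalIdeal_pow_iff_dvd {π : B} (hπ : Irreducible π) (N : ℕ) (b : B) :
    b ∈ maximalIdeal B ^ N ↔ π ^ N ∣ b := by
  rw [hπ.maximalIdeal_eq, Ideal.span_singleton_pow, Ideal.mem_span_singleton]

theorem mem_maximalIdeal_iff_dvd {π : B} (hπ : Irreducible π) (b : B) :
    b ∈ maximalIdeal B ↔ π ∣ b := by
  simpa using mem_maximalIdeal_pow_iff_dvd hπ 1 b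

theorem pow_dvd_iff_le_addVal {π : B} (hπ : Irreducible π) (N : ℕ) (b : B) :
    π ^ N ∣ b ↔ (N : ℕ∞) ≤ addVal B b := by
  rw [← IsDiscreteValuationRing.addVal_le_iff_dvd, hπ.addVal_pow]

theorem eq_zero_of_forall_pow_dvd {π : B} (hπ : Irreducible π) {b : B}
    (h : ∀ N : ℕ, π ^ N ∣ b) : b = 0 := by
  rw [← IsDiscreteValuationRing.addVal_eq_top_iff, ENat.eq_top_iff_forall_ge]
  exact fun N => (pow_dvd_iff_le_addVal hπ N b).1 (h N)

omit [IsDomain B] [IsDiscreteValuationRing B] in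
theorem mem_maximalIdeal_of_irreducible_dvd_algebraMap {π : B} (hπ : Irreducible π) {a : A}
    (ha : π ∣ algebraMap A B a) : a ∈ maximalIdeal A := by
  rw [mem_maximalIdeal]
  exact fun h => hπ.not_isUnit (isUnit_of_dvd_unit ha (h.map _))

/-- The ramification index of `B` over `A` is `n`, in terms of the normalized valuations. -/
def HasRamification (A B : Type*) [CommRing A] [IsDomain A] [IsDiscreteValuationRing A]
    [CommRing B] [IsDomain B] [IsDiscreteValuationRing B] [Algebra A B] (n : ℕ) : Prop :=
  n ≠ 0 ∧ ∀ a : A, addVal B (algebraMap A B a) = n * addVal A a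

theorem hasRamification_of_irreducible {n : ℕ} (hn : n ≠ 0)
    (h : ∀ π : A, Irreducible π → addVal B (algebraMap A B π) = (n : ℕ∞)) :
    HasRamification A B n := by
  refine ⟨hn, fun a => ?_⟩
  obtain ⟨π, hπ⟩ := IsDiscreteValuationRing.exists_irreducible A
  by_cases ha : a = 0
  · subst ha
    simp [ENat.mul_top, hn]
  · obtain ⟨k, u, rfl⟩ := IsDiscreteValuationRing.eq_unit_mul_pow_irreducible ha hπ
    have hu : addVal B (algebraMap A B u) = 0 :=
      IsDiscreteValuationRing.addVal_eq_zero_iff.2 (u.isUnit.map _)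
    rw [map_mul, map_pow, IsDiscreteValuationRing.addVal_mul, IsDiscreteValuationRing.addVal_pow,
      h π hπ, hu, IsDiscreteValuationRing.addVal_def' u hπ]
    simp [mul_comm]

variable {n : ℕ} (hr : HasRamification A B n)
include hr

theorem HasRamification.addVal_uniformizer {πK : A} (hπK : Irreducible πK) :
    addVal B (algebraMap A B πK) = n := by
  rw [hr.2, IsDiscreteValuationRing.addVal_uniformizer hπK, mul_one]

theorem HasRamification.injective : Function.Injective (algebraMap A B) := by
  rw [injective_iff_map_eq_zero]
  intro a ha
  have := hr.2 a
  rw [ha, IsDiscreteValuationRing.addVal_zero, eq_comm] at this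
  by_contra h
  obtain ⟨k, hk⟩ := ENat.ne_top_iff_exists.1
    (fun h' => h (IsDiscreteValuationRing.addVal_eq_top_iff.1 h'))
  rw [← hk] at this
  exact ENat.natCast_ne_top (n * k) (by exact_mod_cast this)

theorem HasRamification.algebraMap_ne_zero {a : A} (ha : a ≠ 0) : algebraMap A B a ≠ 0 :=
  (map_ne_zero_iff _ hr.injective).2 ha

theorem HasRamification.associated {πK : A} (hπK : Irreducible πK) {π : B} (hπ : Irreducible π) :
    Associated (algebraMap A B πK) (π ^ n) := by
  rw [← IsDiscreteValuationRing.addVal_eq_iff_associated, hr.addVal_uniformizer hπK, hπ.addVal_pow]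

theorem HasRamification.pow_dvd_of_mem {π : B} (hπ : Irreducible π) {a : A}
    (ha : a ∈ maximalIdeal A) : π ^ n ∣ algebraMap A B a := by
  obtain ⟨πK, hπK⟩ := IsDiscreteValuationRing.exists_irreducible A
  exact (hr.associated hπK hπ).symm.dvd.trans
    (map_dvd _ ((mem_maximalIdeal_iff_dvd hπK a).1 ha))

/-- Valuations of elements of `A` are multiples of `n`, so the terms have distinct valuations modulo
`n`: modulo `π^(i+1)`, the later terms vanish, and so do the earlier ones by induction. -/
theorem HasRamification.mem_of_pow_dvd_sum {π : B} (hπ : Irreducible π) {c : ℕ → A}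
    (h : π ^ n ∣ ∑ i ∈ Finset.range n, algebraMap A B (c i) * π ^ i) :
    ∀ i < n, c i ∈ maximalIdeal A := by
  intro i
  induction i using Nat.strong_induction_on with
  | _ i ih =>
    intro hi
    apply mem_maximalIdeal_of_irreducible_dvd_algebraMap hπ
    have h1 : π ^ (i + 1) ∣ ∑ i ∈ Finset.range n, algebraMap A B (c i) * π ^ i :=
      (pow_dvd_pow _ hi).trans h
    rw [← Finset.add_sum_erase _ _ (Finset.mem_range.2 hi)] at h1
    have h2 : π ^ (i + 1) ∣ ∑ k ∈ (Finset.range n).erase i, algebraMap A B (c k) * π ^ k := by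
      refine Finset.dvd_sum fun k hk => ?_
      rw [Finset.mem_erase, Finset.mem_range] at hk
      rcases lt_or_gt_of_ne hk.1 with hlt | hgt
      · exact Dvd.dvd.mul_right ((pow_dvd_pow _ hi).trans
          (hr.pow_dvd_of_mem hπ (ih k hlt hk.2))) _
      · exact Dvd.dvd.mul_left (pow_dvd_pow _ hgt) _
    have h3 := (dvd_add_left h2).1 h1
    rw [pow_succ'] at h3
    exact (mul_dvd_mul_iff_right (pow_ne_zero _ hπ.ne_zero)).1 h3

theorem HasRamification.eq_zero_of_sum_eq_zero {π : B} (hπ : Irreducible π) {c : ℕ → A}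
    (h : ∑ i ∈ Finset.range n, algebraMap A B (c i) * π ^ i = 0) : ∀ i < n, c i = 0 := by
  obtain ⟨πK, hπK⟩ := IsDiscreteValuationRing.exists_irreducible A
  suffices H : ∀ (k : ℕ) (c : ℕ → A),
      ∑ i ∈ Finset.range n, algebraMap A B (c i) * π ^ i = 0 → ∀ i < n, πK ^ k ∣ c i from
    fun i hi => eq_zero_of_forall_pow_dvd hπK fun k => H k c h i hi
  intro k
  induction k with
  | zero => simp
  | succ k ih =>
    intro c hc
    have h1 := hr.mem_of_pow_dvd_sum hπ (c := c) (by simp [hc])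
    have h2 : ∀ i, ∃ d, i < n → c i = πK * d := fun i => by
      by_cases hi : i < n
      · obtain ⟨d, hd⟩ := (mem_maximalIdeal_iff_dvd hπK _).1 (h1 i hi)
        exact ⟨d, fun _ => hd⟩
      · exact ⟨0, fun h => absurd h hi⟩
    choose d hd using h2
    have h3 : algebraMap A B πK * ∑ i ∈ Finset.range n, algebraMap A B (d i) * π ^ i = 0 := by
      rw [← hc, Finset.mul_sum]
      refine Finset.sum_congr rfl fun i hi => ?_
      rw [hd i (Finset.mem_range.1 hi), map_mul, mul_assoc]
    have h4 := (mul_eq_zero.1 h3).resolve_left (hr.algebraMap_ne_zero hπK.ne_zero)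
    intro i hi
    rw [hd i hi, pow_succ']
    exact mul_dvd_mul_left _ (ih d h4 i hi)

/-- Removes denominators: a combination divisible by `πK` has all its coefficients divisible by
`πK`, so one factor cancels at a time. -/
theorem HasRamification.exists_sum_of_mul {π : B} (hπ : Irreducible π) {πK : A}
    (hπK : Irreducible πK) (k : ℕ) :
    ∀ (b : B) (c : ℕ → A), algebraMap A B πK ^ k * b =
      ∑ i ∈ Finset.range n, algebraMap A B (c i) * π ^ i →
    ∃ c : ℕ → A, b = ∑ i ∈ Finset.range n, algebraMap A B (c i) * π ^ i := by
  induction k with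
  | zero => exact fun b c h => ⟨c, by simpa using h⟩
  | succ k ih =>
    intro b c hc
    have h1 := hr.mem_of_pow_dvd_sum hπ (c := c) (by
      rw [← hc, pow_succ', mul_assoc]
      exact (hr.associated hπK hπ).symm.dvd.mul_right _)
    have h2 : ∀ i, ∃ d, i < n → c i = πK * d := fun i => by
      by_cases hi : i < n
      · obtain ⟨d, hd⟩ := (mem_maximalIdeal_iff_dvd hπK _).1 (h1 i hi)
        exact ⟨d, fun _ => hd⟩
      · exact ⟨0, fun h => absurd h hi⟩
    choose d hd using h2
    refine ih b d (mul_left_cancel₀ (hr.algebraMap_ne_zero hπK.ne_zero) ?_)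
    rw [← mul_assoc, ← pow_succ', hc, Finset.mul_sum]
    refine Finset.sum_congr rfl fun i hi => ?_
    rw [hd i (Finset.mem_range.1 hi), map_mul, mul_assoc]

end Ramified

/-- `B` is generated over `A` by the powers of any uniformizer. -/
def IsPowerGenerated (A B : Type*) [CommRing A] [CommRing B] [Algebra A B] (n : ℕ) : Prop :=
  ∀ π : B, Irreducible π → ∀ b : B,
    ∃ c : ℕ → A, b = ∑ i ∈ Finset.range n, algebraMap A B (c i) * π ^ i

/-- The first `n` powers of `π` are independent, hence a `K`-basis of `L`; the denominators of the
coordinates of `b` are then cleared by `HasRamification.exists_sum_of_mul`. -/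
theorem isPowerGenerated_of_finrank {A K B L : Type*}
    [CommRing A] [IsDomain A] [IsDiscreteValuationRing A]
    [Field K] [Algebra A K] [IsFractionRing A K]
    [Field L] [Algebra K L] [FiniteDimensional K L]
    [CommRing B] [IsDomain B] [IsDiscreteValuationRing B] [Algebra B L] [IsFractionRing B L]
    [Algebra A B] [Algebra A L] [IsScalarTower A K L] [IsScalarTower A B L]
    (hr : HasRamification A B (Module.finrank K L)) :
    IsPowerGenerated A B (Module.finrank K L) := by
  classical
  intro π hπ b
  set n := Module.finrank K L with hn
  have hinj : Function.Injective (algebraMap B L) := IsFractionRing.injective B L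
  have key : ∀ c : ℕ → A, algebraMap B L (∑ i ∈ Finset.range n, algebraMap A B (c i) * π ^ i) =
      ∑ i : Fin n, c i • algebraMap B L π ^ (i : ℕ) := fun c => by
    rw [map_sum, ← Fin.sum_univ_eq_sum_range
      (fun i => algebraMap B L (algebraMap A B (c i) * π ^ i)) n]
    refine Finset.sum_congr rfl fun i _ => ?_
    rw [map_mul, map_pow, ← IsScalarTower.algebraMap_apply, Algebra.smul_def]
  have hli : LinearIndependent A (fun i : Fin n => algebraMap B L π ^ (i : ℕ)) := by
    rw [Fintype.linearIndependent_iff]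
    intro g hg i
    have h0 := hr.eq_zero_of_sum_eq_zero hπ
      (c := fun i => if h : i < n then g ⟨i, h⟩ else 0) (hinj (by
        rw [key, map_zero, ← hg]
        simp)) i i.2
    simpa using h0
  have hliK := (LinearIndependent.iff_fractionRing A K).1 hli
  have : Nonempty (Fin n) := ⟨⟨0, Nat.pos_of_ne_zero hr.1⟩⟩
  let bas := basisOfLinearIndependentOfCardEqFinrank hliK (by simp [hn])
  obtain ⟨a, ha⟩ := IsLocalization.exist_integer_multiples_of_finset (nonZeroDivisors A)
    (Finset.univ.image fun i : Fin n => bas.repr (algebraMap B L b) i)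
  have h1 : ∀ i : Fin n, ∃ c : A,
      algebraMap A K c = (a : A) • bas.repr (algebraMap B L b) i := fun i =>
    ha _ (Finset.mem_image_of_mem _ (Finset.mem_univ i))
  choose c hc using h1
  have h2 : algebraMap A B a * b = ∑ i ∈ Finset.range n,
      algebraMap A B ((fun i => if h : i < n then c ⟨i, h⟩ else 0) i) * π ^ i := by
    apply hinj
    rw [key, map_mul, ← IsScalarTower.algebraMap_apply]
    conv_lhs => rw [← bas.sum_repr (algebraMap B L b), Finset.mul_sum]
    refine Finset.sum_congr rfl fun i _ => ?_
    simp only [Fin.is_lt, dite_true, Fin.eta]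
    rw [← Algebra.smul_def, ← smul_assoc, ← hc i, algebraMap_smul]
    simp [bas]
  obtain ⟨πK, hπK⟩ := IsDiscreteValuationRing.exists_irreducible A
  obtain ⟨k, u, hu⟩ := IsDiscreteValuationRing.eq_unit_mul_pow_irreducible
    (nonZeroDivisors.coe_ne_zero a) hπK
  refine hr.exists_sum_of_mul hπ hπK k b
    (fun i => (↑u⁻¹ : A) * (if h : i < n then c ⟨i, h⟩ else 0)) ?_
  have h3 : algebraMap A B πK ^ k = algebraMap A B (↑u⁻¹ : A) * algebraMap A B a := by
    rw [← map_mul, hu, ← mul_assoc, Units.inv_mul, one_mul, map_pow]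
  rw [h3, mul_assoc, h2, Finset.mul_sum]
  exact Finset.sum_congr rfl fun i _ => by rw [map_mul, mul_assoc]

/-! ### Evaluation of power series as adic sums. -/

section AdicSum

variable {R S : Type*} [CommRing R] [CommRing S] [Algebra R S] {I : Ideal S} {s : S}

theorem IsAdicSum.unique (hI : ∀ y : S, (∀ N, y ∈ I ^ N) → y = 0) {f : R⟦X⟧} {y z : S}
    (hy : IsAdicSum I f s y) (hz : IsAdicSum I f s z) : y = z := by
  refine sub_eq_zero.1 (hI _ fun N => ?_)
  obtain ⟨M, hM⟩ := hy N
  obtain ⟨M', hM'⟩ := hz N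
  have := (I ^ N).sub_mem (hM' (max M M') (le_max_right _ _)) (hM (max M M') (le_max_left _ _))
  simpa using this

theorem IsAdicSum.C_mul {f : R⟦X⟧} {y : S} (h : IsAdicSum I f s y) (a : R) :
    IsAdicSum I (C a * f) s (a • y) := fun N => by
  obtain ⟨M, hM⟩ := h N
  refine ⟨M, fun M' hM' => ?_⟩
  have := (I ^ N).mul_mem_left (algebraMap R S a) (hM M' hM')
  rw [← Algebra.smul_def, smul_sub, Finset.smul_sum] at this
  simpa only [PowerSeries.coeff_C_mul, mul_smul] using this

theorem IsAdicSum.add {f g : R⟦X⟧} {y z : S} (hf : IsAdicSum I f s y) (hg : IsAdicSum I g s z) :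
    IsAdicSum I (f + g) s (y + z) := fun N => by
  obtain ⟨M, hM⟩ := hf N
  obtain ⟨M', hM'⟩ := hg N
  refine ⟨max M M', fun k hk => ?_⟩
  have := (I ^ N).add_mem (hM k ((le_max_left _ _).trans hk)) (hM' k ((le_max_right _ _).trans hk))
  simp only [map_add, add_smul, Finset.sum_add_distrib]
  rwa [sub_add_sub_comm] at this

theorem IsAdicSum.X_mul {f : R⟦X⟧} {y : S} (h : IsAdicSum I f s y) :
    IsAdicSum I (X * f) s (s * y) := fun N => by
  obtain ⟨M, hM⟩ := h N
  refine ⟨M + 1, fun k hk => ?_⟩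
  obtain ⟨k, rfl⟩ : ∃ l, k = l + 1 := ⟨k - 1, by omega⟩
  have := (I ^ N).mul_mem_left s (hM k (by omega))
  rw [Finset.sum_range_succ']
  simp only [coeff_succ_X_mul, coeff_zero_X_mul, zero_smul, add_zero]
  rw [mul_sub, Finset.mul_sum] at this
  simpa only [pow_succ', mul_smul_comm] using this

/-- Multiplicativity of evaluation is needed only for a polynomial factor, since Weierstrass
division by `E` always supplies one. -/
theorem IsAdicSum.polynomial_mul {f : R⟦X⟧} {y : S} (h : IsAdicSum I f s y) (P : Polynomial R) :
    IsAdicSum I ((P : R⟦X⟧) * f) s (Polynomial.aeval s P * y) := by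
  induction P using Polynomial.induction_on' with
  | add p q hp hq => simpa only [Polynomial.coe_add, add_mul, map_add] using hp.add hq
  | monomial k a =>
    rw [← Polynomial.C_mul_X_pow_eq_monomial]
    induction k with
    | zero =>
      have h1 := h.C_mul a
      rw [Algebra.smul_def] at h1
      simpa using h1
    | succ k ih =>
      have h1 := ih.X_mul
      simp only [Polynomial.coe_mul, Polynomial.coe_pow, Polynomial.coe_C, Polynomial.coe_X,
        map_mul, map_pow, Polynomial.aeval_X, Polynomial.aeval_C] at h1 ⊢
      convert h1 using 1 <;> ring

theorem isAdicSum_one : IsAdicSum I (1 : R⟦X⟧) s 1 := fun N => by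
  refine ⟨1, fun k hk => ?_⟩
  obtain ⟨k, rfl⟩ : ∃ l, k = l + 1 := ⟨k - 1, by omega⟩
  rw [Finset.sum_range_succ']
  simp [coeff_one]

theorem isAdicSum_polynomial (P : Polynomial R) :
    IsAdicSum I (P : R⟦X⟧) s (Polynomial.aeval s P) := by
  simpa using (isAdicSum_one (R := R) (I := I) (s := s)).polynomial_mul P

theorem IsAdicSum.sub_C {f : R⟦X⟧} {y : S} (h : IsAdicSum I f s y) (a : R) :
    IsAdicSum I (f - C a) s (y - algebraMap R S a) := by
  have := h.add (isAdicSum_polynomial (I := I) (s := s) (Polynomial.C (-a)))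
  simpa [sub_eq_add_neg] using this

theorem exists_isAdicSum [IsPrecomplete I S] (hs : s ∈ I) (f : R⟦X⟧) :
    ∃ y, IsAdicSum I f s y := by
  have hc : ∀ m k : ℕ, m ≤ k → (∑ i ∈ Finset.range k, coeff i f • s ^ i) -
      ∑ i ∈ Finset.range m, coeff i f • s ^ i ∈ I ^ m := fun m k hmk => by
    rw [← Finset.sum_Ico_eq_sub _ hmk]
    refine Ideal.sum_mem _ fun i hi => ?_
    rw [Algebra.smul_def]
    exact Ideal.mul_mem_left _ _ (Ideal.pow_le_pow_right (Finset.mem_Ico.1 hi).1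
      (Ideal.pow_mem_pow hs i))
  obtain ⟨y, hy⟩ := IsPrecomplete.prec' (I := I)
    (fun k => ∑ i ∈ Finset.range k, coeff i f • s ^ i) (fun {m k} hmk => by
      rw [smul_eq_mul, Ideal.mul_top, SModEq.comm, SModEq.sub_mem]
      exact hc m k hmk)
  refine ⟨y, fun N => ⟨N, fun M hM => ?_⟩⟩
  have h1 := hy N
  rw [smul_eq_mul, Ideal.mul_top, SModEq.sub_mem] at h1
  have := (I ^ N).add_mem (hc N M hM) h1
  simpa using this

end AdicSum

/-! ### Completeness of `B` and of `B⟦X⟧`. -/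

section Complete

variable {A B : Type*} [CommRing A] [IsDomain A] [IsDiscreteValuationRing A]
  [CommRing B] [IsDomain B] [IsDiscreteValuationRing B] [Algebra A B]

theorem HasRamification.dvd_of_pow_dvd_sum {n : ℕ} (hr : HasRamification A B n)
    (hg : IsPowerGenerated A B n) {πK : A} {π : B} (hπ : Irreducible π)
    {k : ℕ} {c : ℕ → A}
    (h : algebraMap A B πK ^ k ∣ ∑ i ∈ Finset.range n, algebraMap A B (c i) * π ^ i) :
    ∀ i < n, πK ^ k ∣ c i := by
  obtain ⟨b, hb⟩ := h
  obtain ⟨d, rfl⟩ := hg π hπ b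
  intro i hi
  have := hr.eq_zero_of_sum_eq_zero hπ (c := fun i => c i - πK ^ k * d i) (by
    simp only [map_sub, map_mul, map_pow, sub_mul, Finset.sum_sub_distrib, hb, Finset.mul_sum,
      mul_assoc, sub_self]) i hi
  exact ⟨d i, sub_eq_zero.1 this⟩

theorem HasRamification.isPrecomplete [IsAdicComplete (maximalIdeal A) A] {n : ℕ}
    (hr : HasRamification A B n) (hg : IsPowerGenerated A B n) :
    IsPrecomplete (maximalIdeal B) B := by
  obtain ⟨πK, hπK⟩ := IsDiscreteValuationRing.exists_irreducible A
  obtain ⟨π, hπ⟩ := IsDiscreteValuationRing.exists_irreducible B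
  refine ⟨fun f hf => ?_⟩
  simp only [smul_eq_mul, Ideal.mul_top, SModEq.sub_mem, mem_maximalIdeal_pow_iff_dvd hπ] at hf ⊢
  have hpow : ∀ k, Associated (algebraMap A B πK ^ k) (π ^ (n * k)) := fun k => by
    rw [pow_mul]
    exact (hr.associated hπK hπ).pow_pow
  -- Along the indices `n * k` the `π`-adic precision is exactly `πK ^ k`, so the coordinates are
  -- Cauchy in `A`.
  choose c hc using fun k => hg π hπ (f (n * k))
  have h1 : ∀ i, ∃ l : A, i < n → ∀ k, πK ^ k ∣ c k i - l := fun i => by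
    by_cases hi : i < n
    · obtain ⟨l, hl⟩ := IsPrecomplete.prec' (I := maximalIdeal A) (fun k => c k i)
        (fun {m k} hmk => by
          rw [smul_eq_mul, Ideal.mul_top, SModEq.sub_mem, mem_maximalIdeal_pow_iff_dvd hπK]
          refine hr.dvd_of_pow_dvd_sum hg hπ (c := fun i => c m i - c k i) ?_ i hi
          simp only [map_sub, sub_mul, Finset.sum_sub_distrib, ← hc]
          exact (hpow m).dvd.trans (hf (Nat.mul_le_mul_left n hmk)))
      refine ⟨l, fun _ k => ?_⟩
      have := hl k
      rwa [smul_eq_mul, Ideal.mul_top, SModEq.sub_mem, mem_maximalIdeal_pow_iff_dvd hπK] at this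
    · exact ⟨0, fun h => absurd h hi⟩
  choose l hl using h1
  refine ⟨∑ i ∈ Finset.range n, algebraMap A B (l i) * π ^ i, fun k => ?_⟩
  have hk : k ≤ n * k := Nat.le_mul_of_pos_left k (Nat.pos_of_ne_zero hr.1)
  have h2 : π ^ k ∣ f (n * k) - ∑ i ∈ Finset.range n, algebraMap A B (l i) * π ^ i := by
    rw [hc k, ← Finset.sum_sub_distrib]
    refine Finset.dvd_sum fun i hi => ?_
    rw [← sub_mul, ← map_sub]
    refine Dvd.dvd.mul_right ?_ _
    have := map_dvd (algebraMap A B) (hl i (Finset.mem_range.1 hi) k)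
    rw [map_pow] at this
    exact (pow_dvd_pow π hk).trans ((hpow k).symm.dvd.trans this)
  simpa using dvd_add (hf hk) h2

omit [IsDomain B] [IsDiscreteValuationRing B] in
theorem C_dvd_iff {a : B} {G : B⟦X⟧} : C a ∣ G ↔ ∀ i, a ∣ coeff i G := by
  constructor
  · rintro ⟨H, rfl⟩ i
    simp
  · intro h
    choose g hg using h
    exact ⟨PowerSeries.mk g, by ext i; simp [hg i]⟩

theorem mem_map_C_pow_iff {π : B} (hπ : Irreducible π) (N : ℕ) (G : B⟦X⟧) :
    G ∈ (maximalIdeal B).map (C : B →+* B⟦X⟧) ^ N ↔ ∀ i, π ^ N ∣ coeff i G := by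
  rw [hπ.maximalIdeal_eq, Ideal.map_span, Set.image_singleton, Ideal.span_singleton_pow,
    Ideal.mem_span_singleton, ← map_pow, C_dvd_iff]

theorem eq_zero_of_forall_mem_map_C_pow (G : B⟦X⟧)
    (h : ∀ N, G ∈ (maximalIdeal B).map (C : B →+* B⟦X⟧) ^ N) : G = 0 := by
  obtain ⟨π, hπ⟩ := IsDiscreteValuationRing.exists_irreducible B
  ext i
  exact eq_zero_of_forall_pow_dvd hπ fun N => (mem_map_C_pow_iff hπ N G).1 (h N) i

theorem isPrecomplete_map_C [IsPrecomplete (maximalIdeal B) B] :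
    IsPrecomplete ((maximalIdeal B).map (C : B →+* B⟦X⟧)) B⟦X⟧ := by
  obtain ⟨π, hπ⟩ := IsDiscreteValuationRing.exists_irreducible B
  refine ⟨fun f hf => ?_⟩
  simp only [smul_eq_mul, Ideal.mul_top, SModEq.sub_mem, mem_map_C_pow_iff hπ, map_sub] at hf ⊢
  have h1 : ∀ i, ∃ l : B, ∀ k, π ^ k ∣ coeff i (f k) - l := fun i => by
    obtain ⟨l, hl⟩ := IsPrecomplete.prec' (I := maximalIdeal B) (fun k => coeff i (f k))
      (fun {m k} hmk => by
        rw [smul_eq_mul, Ideal.mul_top, SModEq.sub_mem, mem_maximalIdeal_pow_iff_dvd hπ]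
        exact hf hmk i)
    refine ⟨l, fun k => ?_⟩
    have := hl k
    rwa [smul_eq_mul, Ideal.mul_top, SModEq.sub_mem, mem_maximalIdeal_pow_iff_dvd hπ] at this
  choose l hl using h1
  exact ⟨PowerSeries.mk l, fun k i => by simpa using hl i k⟩

end Complete

/-! ### Eisenstein polynomials and Weierstrass division. -/

section Eisenstein

variable {A B : Type*} [CommRing A] [IsDomain A] [IsDiscreteValuationRing A]
  [CommRing B] [IsDomain B] [IsDiscreteValuationRing B] [Algebra A B]

/-- `E` is an Eisenstein polynomial of degree `n` with root `π`. -/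
structure IsEisensteinFor (n : ℕ) (π : B) (E : Polynomial A) : Prop where
  monic : E.Monic
  natDegree : E.natDegree = n
  aeval : Polynomial.aeval π E = 0
  irreducible : Irreducible (E.coeff 0)
  mem : ∀ i < n, E.coeff i ∈ maximalIdeal A

theorem natDegree_lt_of_degree_lt {R : Type*} [CommRing R] {n : ℕ} (hn : n ≠ 0)
    {P : Polynomial R} (hP : P.degree < n) : P.natDegree < n := by
  by_cases h : P = 0
  · simpa [h] using Nat.pos_of_ne_zero hn
  · exact (Polynomial.natDegree_lt_iff_degree_lt h).2 hP

omit [IsDomain A] [IsDiscreteValuationRing A] [IsDomain B] [IsDiscreteValuationRing B] in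
theorem aeval_eq_sum_algebraMap {n : ℕ} (π : B) {P : Polynomial A} (hP : P.natDegree < n) :
    Polynomial.aeval π P = ∑ i ∈ Finset.range n, algebraMap A B (P.coeff i) * π ^ i := by
  rw [Polynomial.aeval_eq_sum_range' hP]
  simp [Algebra.smul_def]

theorem HasRamification.eq_zero_of_aeval {n : ℕ} (hr : HasRamification A B n) {π : B} (hπ : Irreducible π) {P : Polynomial A}
    (hP : P.natDegree < n) (h : Polynomial.aeval π P = 0) : P = 0 := by
  rw [aeval_eq_sum_algebraMap π hP] at h
  ext i
  by_cases hi : i < n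
  · simpa using hr.eq_zero_of_sum_eq_zero hπ h i hi
  · simpa using Polynomial.coeff_eq_zero_of_natDegree_lt (by omega)

theorem HasRamification.exists_isEisensteinFor {n : ℕ} (hr : HasRamification A B n)
    (hg : IsPowerGenerated A B n) {π : B} (hπ : Irreducible π) :
    ∃ E : Polynomial A, IsEisensteinFor n π E := by
  obtain ⟨c, hc⟩ := hg π hπ (π ^ n)
  have hmem := hr.mem_of_pow_dvd_sum hπ (c := c) (by rw [← hc])
  have hn := Nat.pos_of_ne_zero hr.1
  set P : Polynomial A := ∑ i ∈ Finset.range n, Polynomial.C (c i) * Polynomial.X ^ i with hP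
  have hdeg : P.degree < n := by
    refine (Polynomial.degree_sum_le _ _).trans_lt ((Finset.sup_lt_iff (by
      exact WithBot.bot_lt_coe n)).2 fun i hi => ?_)
    exact (Polynomial.degree_C_mul_X_pow_le _ _).trans_lt
      (by exact_mod_cast Finset.mem_range.1 hi)
  have hcoeff : ∀ i < n, (Polynomial.X ^ n - P).coeff i = - c i := fun i hi => by
    rw [Polynomial.coeff_sub, Polynomial.coeff_X_pow, if_neg hi.ne, hP,
      Polynomial.finsetSum_coeff]
    simp [Polynomial.coeff_C_mul, Polynomial.coeff_X_pow, hi]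
  have hirr : Irreducible (c 0) := by
    obtain ⟨πK, hπK⟩ := IsDiscreteValuationRing.exists_irreducible A
    obtain ⟨u, hu⟩ := (mem_maximalIdeal_iff_dvd hπK _).1 (hmem 0 hn)
    -- All other terms of the expansion of `π ^ n` are divisible by `π ^ (n + 1)`, so the constant
    -- one is not.
    have hnd : ¬ π ^ (n + 1) ∣ algebraMap A B (c 0) := fun h => by
      have : π ^ (n + 1) ∣ π ^ n := by
        rw [hc]
        refine Finset.dvd_sum fun i hi => ?_
        rcases Nat.eq_zero_or_pos i with rfl | hi0
        · exact h.mul_right _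
        · rw [pow_add]
          exact mul_dvd_mul (hr.pow_dvd_of_mem hπ (hmem i (Finset.mem_range.1 hi)))
            (pow_dvd_pow _ hi0)
      exact absurd ((pow_dvd_pow_iff hπ.ne_zero hπ.not_isUnit).1 this) (by omega)
    have hunit : IsUnit u := by
      by_contra hcon
      refine hnd ?_
      rw [hu, map_mul]
      refine (pow_dvd_pow π (by omega : n + 1 ≤ n + n)).trans ?_
      rw [pow_add]
      exact mul_dvd_mul (hr.associated hπK hπ).symm.dvd
        (hr.pow_dvd_of_mem hπ ((mem_maximalIdeal u).2 hcon))
    rw [hu]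
    exact (irreducible_mul_isUnit hunit).2 hπK
  refine ⟨Polynomial.X ^ n - P, Polynomial.monic_X_pow_sub hdeg, ?_, ?_, ?_, ?_⟩
  · rw [Polynomial.natDegree_sub_eq_left_of_natDegree_lt, Polynomial.natDegree_X_pow]
    rw [Polynomial.natDegree_X_pow]
    exact natDegree_lt_of_degree_lt hn.ne' hdeg
  · rw [map_sub, map_pow, Polynomial.aeval_X, hP, map_sum, sub_eq_zero, hc]
    simp
  · rw [hcoeff 0 hn]
    rw [← neg_one_mul]
    exact (irreducible_isUnit_mul isUnit_one.neg).2 hirr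
  · intro i hi
    rw [hcoeff i hi]
    exact neg_mem (hmem i hi)

namespace IsEisensteinFor

variable {n : ℕ} {π : B} {E : Polynomial A} (hE : IsEisensteinFor n π E)
include hE

theorem dvd_of_aeval (hr : HasRamification A B n) (hπ : Irreducible π) {P : Polynomial A}
    (h : Polynomial.aeval π P = 0) : E ∣ P := by
  rw [← Polynomial.modByMonic_eq_zero_iff_dvd hE.monic]
  refine hr.eq_zero_of_aeval hπ ?_ ?_
  · refine (Polynomial.natDegree_modByMonic_lt P hE.monic fun h1 => ?_).trans_eq hE.natDegree
    exact hr.1 (by rw [← hE.natDegree, h1, Polynomial.natDegree_one])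
  · rw [Polynomial.modByMonic_eq_sub_mul_div, map_sub, map_mul, hE.aeval, h]
    simp

omit [IsDomain B] [IsDiscreteValuationRing B] in
theorem isDistinguishedAt : E.IsDistinguishedAt (maximalIdeal A) where
  mem := fun {i} hi => hE.mem i (hE.natDegree ▸ hi)
  monic := hE.monic

/-- The Weierstrass remainder of `F` has degree less than `n` and vanishes at `π`, so it is zero. -/
theorem exists_eq_mul_of_isAdicSum [IsAdicComplete (maximalIdeal A) A]
    (hr : HasRamification A B n) (hg : IsPowerGenerated A B n) (hπ : Irreducible π) {F : A⟦X⟧}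
    (h : IsAdicSum (maximalIdeal B) F π 0) : ∃ Q : A⟦X⟧, F = (E : A⟦X⟧) * Q := by
  have hD := hE.isDistinguishedAt
  have h1 := (hD.isWeierstrassDivisorAt'.isWeierstrassDivisionAt_div_mod F)
  set q := hD.isWeierstrassDivisorAt'.div F
  set r := hD.isWeierstrassDivisorAt'.mod F
  have horder : n = ((E : A⟦X⟧).map (Ideal.Quotient.mk (maximalIdeal A))).order.toNat := by
    rw [← hE.natDegree]
    exact congr(ENat.toNat $(hD.coe_natDegree_eq_order_map (E : A⟦X⟧) 1
      (by rw [constantCoeff_one, ← Ideal.ne_top_iff_one]; exact Ideal.IsPrime.ne_top inferInstance)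
      (by simp)))
  have hdeg := h1.degree_lt
  rw [← horder] at hdeg
  have hpre := hr.isPrecomplete hg
  obtain ⟨y, hy⟩ := exists_isAdicSum ((mem_maximalIdeal π).2 hπ.not_isUnit) q
  have h2 := (hy.polynomial_mul E).add (isAdicSum_polynomial r)
  rw [← h1.eq_mul_add, hE.aeval, zero_mul, zero_add] at h2
  have h3 := h.unique (fun y hy => eq_zero_of_forall_pow_dvd hπ fun N =>
    (mem_maximalIdeal_pow_iff_dvd hπ N y).1 (hy N)) h2
  have h4 : r = 0 := hr.eq_zero_of_aeval hπ (natDegree_lt_of_degree_lt hr.1 hdeg) h3.symm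
  refine ⟨q, ?_⟩
  rw [h1.eq_mul_add, h4]
  simp

end IsEisensteinFor

end Eisenstein

/-! ### Comparison of the ideals generated by initial coefficients. -/

section CoeffDvd

variable {B : Type*} [CommRing B]

/-- Every common divisor of the first coefficients of `H` (up to degree `i`) divides the
coefficient of degree `i` of `G`. -/
def CoeffDvd (G H : B⟦X⟧) : Prop :=
  ∀ (i : ℕ) (d : B), (∀ k ≤ i, d ∣ coeff k H) → d ∣ coeff i G

theorem CoeffDvd.trans {G H J : B⟦X⟧} (h : CoeffDvd G H) (h' : CoeffDvd H J) : CoeffDvd G J :=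
  fun i d hd => h i d fun k hk => h' k d fun l hl => hd l (hl.trans hk)

theorem coeffDvd_mul_left (U H : B⟦X⟧) : CoeffDvd (U * H) H := fun i d hd => by
  rw [coeff_mul]
  exact Finset.dvd_sum fun x hx =>
    Dvd.dvd.mul_left (hd _ (by have := Finset.HasAntidiagonal.mem_antidiagonal.1 hx; omega)) _

theorem coeffDvd_mul_left_of_isUnit {U : B⟦X⟧} (hU : IsUnit U) (H : B⟦X⟧) :
    CoeffDvd H (U * H) := by
  obtain ⟨u, rfl⟩ := hU
  simpa using coeffDvd_mul_left (↑u⁻¹ : B⟦X⟧) (u * H)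

theorem CoeffDvd.of_C_mul [IsDomain B] {a : B} (ha : a ≠ 0) {G H : B⟦X⟧}
    (h : CoeffDvd (C a * G) (C a * H)) : CoeffDvd G H := fun i d hd => by
  have := h i (a * d) fun k hk => by
    rw [coeff_C_mul]
    exact mul_dvd_mul_left a (hd k hk)
  rw [coeff_C_mul] at this
  exact (mul_dvd_mul_iff_left ha).1 this

/-- `D ^ k` begins in degree at least `k`, so only the coefficients of `q` up to degree `i` reach
degree `i`. -/
theorem coeffDvd_aeval {D : B⟦X⟧} (hD : X ∣ D) (q : Polynomial B) :
    CoeffDvd (Polynomial.aeval D q) (q : B⟦X⟧) := fun i d hd => by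
  rw [Polynomial.aeval_eq_sum_range, map_sum]
  refine Finset.dvd_sum fun k _ => ?_
  rw [PowerSeries.smul_eq_C_mul, coeff_C_mul]
  by_cases hk : k ≤ i
  · have := hd k hk
    rw [Polynomial.coeff_coe] at this
    exact this.mul_right _
  · rw [X_pow_dvd_iff.1 (pow_dvd_pow_of_dvd hD k) i (not_le.1 hk), mul_zero]
    exact dvd_zero d

end CoeffDvd

/-! ### The expansion of a polynomial at `π(1 + ε)`. -/

section Translate

variable {A B : Type*} [CommRing A] [CommRing B] [Algebra A B]

/-- The expansion `P(π(1 + ε))` of a polynomial. -/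
noncomputable def translate (π : B) (P : Polynomial A) : B⟦X⟧ :=
  Polynomial.aeval (C π + C π * X : B⟦X⟧) P

variable (A) in
/-- The inclusion of polynomials in power series, over a smaller ring of coefficients. -/
noncomputable def polyToPowerSeries : Polynomial B →ₐ[A] B⟦X⟧ :=
  { Polynomial.coeToPowerSeries.ringHom with
    commutes' := fun a => by
      simp [IsScalarTower.algebraMap_apply A B (Polynomial B), PowerSeries.algebraMap_apply] }

theorem polyToPowerSeries_apply (q : Polynomial B) : polyToPowerSeries A q = (q : B⟦X⟧) := rfl

theorem constantCoeff_aeval (s : B⟦X⟧) (P : Polynomial A) :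
    constantCoeff (Polynomial.aeval s P) = Polynomial.aeval (constantCoeff s) P := by
  rw [Polynomial.aeval_def, Polynomial.hom_eval₂, Polynomial.aeval_def]
  congr 1

theorem constantCoeff_translate (π : B) (P : Polynomial A) :
    constantCoeff (translate π P) = Polynomial.aeval π P := by
  simp [translate, constantCoeff_aeval]

theorem coeffDvd_aeval_translate (π : B) {D : B⟦X⟧} (hD : X ∣ D) (E : Polynomial A) :
    CoeffDvd (Polynomial.aeval (C π + C π * D) E) (translate π E) := by
  set q : Polynomial B :=
    Polynomial.aeval (Polynomial.C π + Polynomial.C π * Polynomial.X : Polynomial B) E with hq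
  have h1 : translate π E = (q : B⟦X⟧) := by
    rw [translate, ← polyToPowerSeries_apply (A := A), hq, ← Polynomial.aeval_algHom_apply]
    simp [polyToPowerSeries_apply]
  have h2 : Polynomial.aeval (C π + C π * D) E = Polynomial.aeval D q := by
    have := Polynomial.aeval_algHom_apply ((Polynomial.aeval (R := B) D).restrictScalars A)
      (Polynomial.C π + Polynomial.C π * Polynomial.X) E
    simp only [AlgHom.restrictScalars_apply] at this
    rw [hq, ← this]
    simp
  rw [h1, h2]
  exact coeffDvd_aeval hD q

theorem coeff_translate_pow (π : B) (m i : ℕ) :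
    coeff i ((C π + C π * X : B⟦X⟧) ^ m) = (m.choose i : B) * π ^ m := by
  have h : (C π + C π * X : B⟦X⟧) ^ m =
      C (π ^ m) * (((1 + Polynomial.X) ^ m : Polynomial B) : B⟦X⟧) := by
    push_cast
    rw [map_pow, ← mul_pow]
    ring
  rw [h, coeff_C_mul, Polynomial.coeff_coe, Polynomial.coeff_one_add_X_pow, mul_comm]

end Translate

/-! ### Independence of the uniformizers and of the series `F`. -/

section Change

variable {A B : Type*} [CommRing A] [IsDomain A] [IsDiscreteValuationRing A]
  [CommRing B] [IsDomain B] [IsDiscreteValuationRing B] [Algebra A B]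

theorem eq_zero_of_forall_mem_maximalIdeal_pow (y : B) (h : ∀ N, y ∈ maximalIdeal B ^ N) :
    y = 0 := by
  obtain ⟨π, hπ⟩ := IsDiscreteValuationRing.exists_irreducible B
  exact eq_zero_of_forall_pow_dvd hπ fun N => (mem_maximalIdeal_pow_iff_dvd hπ N y).1 (h N)

omit [IsDomain A] [IsDiscreteValuationRing A] in
theorem IsAdicSum.exists_dvd_coeff {π : B} (hπ : Irreducible π) {f : A⟦X⟧} {y : B⟦X⟧}
    (h : IsAdicSum ((maximalIdeal B).map (C : B →+* B⟦X⟧)) f (C π + C π * X) y) (i N : ℕ) :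
    ∃ M₀ : ℕ, ∀ M ≥ M₀, π ^ N ∣ (∑ m ∈ Finset.range M,
      algebraMap A B (coeff m f) * (m.choose i * π ^ m)) - coeff i y := by
  obtain ⟨M₀, hM₀⟩ := h N
  refine ⟨M₀, fun M hM => ?_⟩
  have := (mem_map_C_pow_iff hπ N _).1 (hM₀ M hM) i
  simpa only [map_sub, map_sum, Algebra.smul_def, PowerSeries.algebraMap_apply, coeff_C_mul,
    coeff_translate_pow] using this

omit [IsDomain A] [IsDiscreteValuationRing A] in
theorem IsAdicSum.constantCoeff {π : B} (hπ : Irreducible π) {f : A⟦X⟧} {y : B⟦X⟧}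
    (h : IsAdicSum ((maximalIdeal B).map (C : B →+* B⟦X⟧)) f (C π + C π * X) y) :
    IsAdicSum (maximalIdeal B) f π (constantCoeff y) := fun N => by
  obtain ⟨M₀, hM₀⟩ := h.exists_dvd_coeff hπ 0 N
  refine ⟨M₀, fun M hM => ?_⟩
  rw [mem_maximalIdeal_pow_iff_dvd hπ]
  simpa [Algebra.smul_def] using hM₀ M hM

omit [IsDomain A] [IsDiscreteValuationRing A] in
theorem IsAdicSum.isUnit {π : B} (hπ : Irreducible π) {f : A⟦X⟧} {y : B}
    (h : IsAdicSum (maximalIdeal B) f π y) (hf : IsUnit (coeff 0 f)) : IsUnit y := by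
  obtain ⟨M, hM⟩ := h 1
  have h1 := hM (M + 1) (Nat.le_succ M)
  rw [mem_maximalIdeal_pow_iff_dvd hπ, pow_one, Finset.sum_range_succ'] at h1
  by_contra hy
  rw [← mem_nonunits_iff, ← mem_maximalIdeal, mem_maximalIdeal_iff_dvd hπ] at hy
  have h2 : π ∣ ∑ k ∈ Finset.range M, coeff (k + 1) f • π ^ (k + 1) :=
    Finset.dvd_sum fun k _ => by
      rw [Algebra.smul_def]
      exact Dvd.dvd.mul_left (dvd_pow_self π k.succ_ne_zero) _
  have h3 := (dvd_add_right h2).1 ((dvd_sub_left hy).1 h1)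
  rw [pow_zero, Algebra.smul_def, mul_one] at h3
  exact hπ.not_isUnit (isUnit_of_dvd_unit h3 (hf.map _))

variable {n : ℕ} (hr : HasRamification A B n) (hg : IsPowerGenerated A B n)
include hr hg

/-- With `π' = π U(π)`, the polynomial `E'(X U(X))` vanishes at `π`, hence equals `E * Q`; expanded
at `π(1 + ε)`, it is `E'` at `π'` times a series with constant term `1`. -/
theorem HasRamification.coeffDvd_translate {π π' : B} (hπ : Irreducible π)
    (hπ' : Irreducible π') {E E' : Polynomial A} (hE : IsEisensteinFor n π E)
    (hE' : IsEisensteinFor n π' E') : CoeffDvd (translate π E) (translate π' E') := by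
  obtain ⟨u, hu⟩ := IsDiscreteValuationRing.associated_of_irreducible B hπ hπ'
  obtain ⟨c, hc⟩ := hg π hπ u
  set U : Polynomial A := ∑ i ∈ Finset.range n, Polynomial.C (c i) * Polynomial.X ^ i with hU
  have hUπ : Polynomial.aeval π U = u := by
    rw [hc, hU, map_sum]
    simp
  obtain ⟨Q, hQ⟩ := hE.dvd_of_aeval hr hπ (P := E'.comp (Polynomial.X * U)) (by
    rw [Polynomial.aeval_comp, map_mul, Polynomial.aeval_X, hUπ, hu, hE'.aeval])
  -- Constant terms give `E'(0) = E(0) Q(0)`, with `E'(0)` and `E(0)` both irreducible.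
  have hQ0 : IsUnit (Q.coeff 0) := by
    have h1 := congrArg (fun P => Polynomial.coeff P 0) hQ
    simp only [Polynomial.mul_coeff_zero] at h1
    rw [Polynomial.coeff_zero_eq_eval_zero (E'.comp _), Polynomial.eval_comp] at h1
    simp only [Polynomial.eval_mul, Polynomial.eval_X, zero_mul] at h1
    rw [← Polynomial.coeff_zero_eq_eval_zero] at h1
    have h2 := hE'.irreducible
    rw [h1] at h2
    exact (h2.isUnit_or_isUnit rfl).resolve_left hE.irreducible.not_isUnit
  have hTQ : IsUnit (translate π Q) := by
    rw [PowerSeries.isUnit_iff_constantCoeff, constantCoeff_translate]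
    exact (isAdicSum_polynomial (I := maximalIdeal B) (s := π) Q).isUnit hπ (by simpa using hQ0)
  set W : B⟦X⟧ := translate π (Polynomial.X * U) with hW
  have hW0 : constantCoeff W = π' := by
    rw [hW, constantCoeff_translate, map_mul, Polynomial.aeval_X, hUπ, hu]
  obtain ⟨D', hD'⟩ : C π' ∣ W := by
    have h1 : C π' ∣ C π := map_dvd _ ⟨(↑u⁻¹ : B), by rw [← hu, Units.mul_inv_cancel_right]⟩
    refine h1.trans ?_
    rw [hW, translate, map_mul, Polynomial.aeval_X]
    exact Dvd.dvd.mul_right (dvd_add dvd_rfl (dvd_mul_right _ _)) _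
  have hD'0 : constantCoeff D' = 1 := by
    rw [hD', map_mul, constantCoeff_C] at hW0
    exact mul_left_cancel₀ hπ'.ne_zero (hW0.trans (mul_one π').symm)
  have hD : X ∣ D' - 1 := by
    rw [X_dvd_iff, map_sub, hD'0, map_one, sub_self]
  have h1 : translate π Q * translate π E =
      Polynomial.aeval (C π' + C π' * (D' - 1)) E' := by
    have h2 : translate π (E'.comp (Polynomial.X * U)) = Polynomial.aeval W E' := by
      rw [translate, Polynomial.aeval_comp]
      rfl
    have h3 : C π' + C π' * (D' - 1) = W := by
      rw [hD']
      ring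
    rw [h3, ← h2, hQ, mul_comm]
    simp [translate]
  have h4 := coeffDvd_aeval_translate π' hD E'
  rw [← h1] at h4
  exact (coeffDvd_mul_left_of_isUnit hTQ _).trans h4

variable [IsAdicComplete (maximalIdeal A) A]

theorem HasRamification.exists_isAdicSum_translate {π : B} (hπ : Irreducible π)
    {E : Polynomial A} (hE : IsEisensteinFor n π E) {πK : A} (hπK : Irreducible πK) {F : A⟦X⟧}
    (hF : X ^ n ∣ F) (hFπ : IsAdicSum (maximalIdeal B) F π (algebraMap A B πK)) :
    ∃ y : B⟦X⟧,
      IsAdicSum ((maximalIdeal B).map (C : B →+* B⟦X⟧)) F (C π + C π * X) y ∧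
      CoeffDvd (y - C (algebraMap A B πK)) (translate π E) ∧
      CoeffDvd (translate π E) (y - C (algebraMap A B πK)) := by
  have hpre := hr.isPrecomplete hg
  have hpre' := isPrecomplete_map_C (B := B)
  have hs : (C π + C π * X : B⟦X⟧) ∈ (maximalIdeal B).map (C : B →+* B⟦X⟧) := by
    have : (C π : B⟦X⟧) ∈ (maximalIdeal B).map (C : B →+* B⟦X⟧) :=
      Ideal.mem_map_of_mem _ ((mem_maximalIdeal π).2 hπ.not_isUnit)
    exact Ideal.add_mem _ this (Ideal.mul_mem_right _ _ this)
  obtain ⟨y, hy⟩ := exists_isAdicSum hs F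
  have h0 := hFπ.sub_C πK
  rw [sub_self] at h0
  obtain ⟨Q, hQ⟩ := hE.exists_eq_mul_of_isAdicSum hr hg hπ h0
  -- Since `F` starts in degree `n > 0`, the constant term of `F - πK` is `-πK`, and `E(0)` is
  -- irreducible too.
  have hQ0 : IsUnit (coeff 0 Q) := by
    have h1 := congrArg (coeff 0) hQ
    rw [map_sub, X_pow_dvd_iff.1 hF 0 (Nat.pos_of_ne_zero hr.1), coeff_zero_C, zero_sub,
      coeff_zero_eq_constantCoeff_apply, map_mul, ← coeff_zero_eq_constantCoeff_apply,
      ← coeff_zero_eq_constantCoeff_apply, Polynomial.coeff_coe] at h1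
    have h2 : Irreducible (-πK) := by
      rw [← neg_one_mul]
      exact (irreducible_isUnit_mul isUnit_one.neg).2 hπK
    rw [h1] at h2
    exact (h2.isUnit_or_isUnit rfl).resolve_left hE.irreducible.not_isUnit
  obtain ⟨z, hz⟩ := exists_isAdicSum hs Q
  have hzu : IsUnit z := by
    rw [PowerSeries.isUnit_iff_constantCoeff]
    exact (hz.constantCoeff hπ).isUnit hπ hQ0
  have h1 := hz.polynomial_mul E
  rw [← hQ] at h1
  have h2 : y - C (algebraMap A B πK) = z * translate π E := by
    have := (hy.sub_C πK).unique eq_zero_of_forall_mem_map_C_pow h1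
    rw [PowerSeries.algebraMap_apply] at this
    rw [this, mul_comm]
    rfl
  refine ⟨y, hy, ?_, ?_⟩ <;> rw [h2]
  · exact coeffDvd_mul_left _ _
  · exact coeffDvd_mul_left_of_isUnit hzu _

theorem HasRamification.starSeries_spec {π : B} (hπ : Irreducible π) {πK : A}
    (hπK : Irreducible πK) {F : A⟦X⟧} (hF : X ^ n ∣ F)
    (hFπ : IsAdicSum (maximalIdeal B) F π (algebraMap A B πK)) :
    IsAdicSum ((maximalIdeal B).map (C : B →+* B⟦X⟧)) F (C π + C π * X)
      (C (algebraMap A B πK) * starSeries πK π F + C (algebraMap A B πK)) := by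
  obtain ⟨E, hE⟩ := hr.exists_isEisensteinFor hg hπ
  obtain ⟨y, hy, -, -⟩ := hr.exists_isAdicSum_translate hg hπ hE hπK hF hFπ
  have hev : adicEval ((maximalIdeal B).map (C : B →+* B⟦X⟧)) F (C π + C π * X) = y :=
    (Classical.epsilon_spec (p := fun y => IsAdicSum _ F (C π + C π * X) y) ⟨y, hy⟩).unique
      eq_zero_of_forall_mem_map_C_pow hy
  -- All terms of `F` have degree at least `n` and `π ^ n` is associated to `πK`; so the division
  -- defining `F^*` is possible and the choice in `starSeries` is meaningful.
  have hdvd : C (algebraMap A B πK) ∣ y - C (algebraMap A B πK) := by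
    refine dvd_sub (C_dvd_iff.2 fun i => (hr.associated hπK hπ).dvd.trans ?_) dvd_rfl
    obtain ⟨M, hM⟩ := hy.exists_dvd_coeff hπ i n
    refine (dvd_sub_right (Finset.dvd_sum fun m _ => ?_)).1 (hM M le_rfl)
    by_cases hm : m < n
    · simp [X_pow_dvd_iff.1 hF m hm]
    · exact Dvd.dvd.mul_left (Dvd.dvd.mul_left (pow_dvd_pow _ (not_lt.1 hm)) _) _
  obtain ⟨G, hG⟩ := hdvd
  have hspec : C (algebraMap A B πK) * starSeries πK π F = y - C (algebraMap A B πK) := by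
    refine Eq.trans (Classical.epsilon_spec (p := fun G : B⟦X⟧ => C (algebraMap A B πK) * G =
      adicEval ((maximalIdeal B).map (C : B →+* B⟦X⟧)) F (C π + C π * X)
        - C (algebraMap A B πK)) ⟨G, by rw [hev, hG]⟩) ?_
    rw [hev]
  rw [hspec, sub_add_cancel]
  exact hy

theorem HasRamification.coeffDvd_C_mul_starSeries {π : B} (hπ : Irreducible π)
    {E : Polynomial A} (hE : IsEisensteinFor n π E) {πK : A} (hπK : Irreducible πK) {F : A⟦X⟧}
    (hF : X ^ n ∣ F) (hFπ : IsAdicSum (maximalIdeal B) F π (algebraMap A B πK)) :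
    CoeffDvd (C (algebraMap A B πK) * starSeries πK π F) (translate π E) ∧
      CoeffDvd (translate π E) (C (algebraMap A B πK) * starSeries πK π F) := by
  obtain ⟨y, hy, h1⟩ := hr.exists_isAdicSum_translate hg hπ hE hπK hF hFπ
  have h2 := hy.unique eq_zero_of_forall_mem_map_C_pow (hr.starSeries_spec hg hπ hπK hF hFπ)
  rwa [← eq_sub_of_add_eq h2.symm] at h1

theorem HasRamification.coeffDvd_starSeries {π π' : B} (hπ : Irreducible π)
    (hπ' : Irreducible π') {πK πK' : A} (hπK : Irreducible πK) (hπK' : Irreducible πK')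
    {F F' : A⟦X⟧} (hF : X ^ n ∣ F) (hF' : X ^ n ∣ F')
    (hFπ : IsAdicSum (maximalIdeal B) F π (algebraMap A B πK))
    (hFπ' : IsAdicSum (maximalIdeal B) F' π' (algebraMap A B πK')) :
    CoeffDvd (starSeries πK π F : B⟦X⟧) (starSeries πK' π' F') := by
  obtain ⟨E, hE⟩ := hr.exists_isEisensteinFor hg hπ
  obtain ⟨E', hE'⟩ := hr.exists_isEisensteinFor hg hπ'
  have h1 := (hr.coeffDvd_C_mul_starSeries hg hπ hE hπK hF hFπ).1
  have h2 := (hr.coeffDvd_C_mul_starSeries hg hπ' hE' hπK' hF' hFπ').2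
  have h3 := (h1.trans (hr.coeffDvd_translate hg hπ hπ' hE hE')).trans h2
  obtain ⟨v, hv⟩ := IsDiscreteValuationRing.associated_of_irreducible A hπK hπK'
  refine CoeffDvd.of_C_mul (hr.algebraMap_ne_zero hπK.ne_zero) (h3.trans ?_)
  generalize (starSeries πK' π' F' : B⟦X⟧) = G
  rw [← hv, mul_comm πK, map_mul, map_mul, mul_assoc]
  exact coeffDvd_mul_left _ _

theorem HasRamification.coeff_zero_starSeries {π : B} (hπ : Irreducible π) {πK : A}
    (hπK : Irreducible πK) {F : A⟦X⟧} (hF : X ^ n ∣ F)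
    (hFπ : IsAdicSum (maximalIdeal B) F π (algebraMap A B πK)) :
    coeff 0 (starSeries πK π F : B⟦X⟧) = 0 := by
  have h1 := ((hr.starSeries_spec hg hπ hπK hF hFπ).constantCoeff hπ).unique
    eq_zero_of_forall_mem_maximalIdeal_pow hFπ
  rw [map_add, map_mul, constantCoeff_C, add_eq_right] at h1
  simpa using (mul_eq_zero.1 h1).resolve_left (hr.algebraMap_ne_zero hπK.ne_zero)

end Change

/-! ### From coefficient ideals to valuation functions. -/

section Psi

variable {B : Type*} [CommRing B] [IsDomain B] [IsDiscreteValuationRing B]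

theorem CoeffDvd.exists_addVal_le {G H : B⟦X⟧} (h : CoeffDvd G H) (hH : coeff 0 H = 0) {i : ℕ}
    (hi : 1 ≤ i) : ∃ k, 1 ≤ k ∧ k ≤ i ∧ addVal B (coeff k H) ≤ addVal B (coeff i G) := by
  obtain ⟨k, hk, hmin⟩ := Finset.exists_min_image (Finset.Icc 1 i)
    (fun k => addVal B (coeff k H)) ⟨1, Finset.mem_Icc.2 ⟨le_rfl, hi⟩⟩
  rw [Finset.mem_Icc] at hk
  refine ⟨k, hk.1, hk.2, IsDiscreteValuationRing.addVal_le_iff_dvd.2 (h i _ fun l hl => ?_)⟩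
  rcases Nat.eq_zero_or_pos l with rfl | hl0
  · rw [hH]
    exact dvd_zero _
  · exact IsDiscreteValuationRing.addVal_le_iff_dvd.1 (hmin l (Finset.mem_Icc.2 ⟨hl0, hl⟩))

omit [IsDomain B] [IsDiscreteValuationRing B] in
theorem coeff_trunc_coe (N i : ℕ) (G : B⟦X⟧) :
    coeff i ((trunc N G : Polynomial B) : B⟦X⟧) = if i < N then coeff i G else 0 := by
  rw [Polynomial.coeff_coe, coeff_trunc]

/-- Each term of `G` is bounded below by a term of `H` of no larger degree, which therefore also
survives the truncation. -/
theorem CoeffDvd.Psi_trunc_le {G H : B⟦X⟧} (h : CoeffDvd G H) (hH : coeff 0 H = 0) (N : ℕ)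
    (x : ℝ≥0) : Psi ((trunc N H : Polynomial B) : B⟦X⟧) x ≤
      Psi ((trunc N G : Polynomial B) : B⟦X⟧) x := by
  refine le_iInf₂ fun i hi => ?_
  rw [coeff_trunc_coe]
  split_ifs with hiN
  · obtain ⟨k, hk1, hki, hk⟩ := h.exists_addVal_le hH hi
    refine (iInf₂_le k hk1).trans ?_
    rw [coeff_trunc_coe, if_pos (hki.trans_lt hiN)]
    gcongr
  · simp

end Psi

/-! ### Teichmüller expansions and the role of separability. -/

section Teichmuller

theorem charP_of_prime_of_natCast_eq_zero {R : Type*} [CommRing R] [Nontrivial R] {p : ℕ}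
    (hp : p.Prime) (h : (p : R) = 0) : CharP R p :=
  CharP.ringChar_of_prime_eq_zero hp h ▸ ringChar.charP R

variable (p : ℕ) [Fact p.Prime]
  {A B : Type*} [CommRing A] [IsDomain A] [IsDiscreteValuationRing A]
  [IsAdicComplete (maximalIdeal A) A] [CharP (A ⧸ maximalIdeal A) p]

theorem zero_mem_teichmullerReps : (0 : A) ∈ teichmullerReps p A := ⟨0, map_zero _⟩

theorem exists_pow_eq_of_mem_teichmullerReps {t : A} (ht : t ∈ teichmullerReps p A) :
    ∃ b : A, b ^ p = t := by
  obtain ⟨x, rfl⟩ := ht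
  refine ⟨Perfection.teichmuller₀ p (maximalIdeal A) (Perfection.pthRoot _ p x), ?_⟩
  rw [← map_pow]
  congr 1
  exact RingHom.congr_fun (Perfection.frobenius_pthRoot (R := A ⧸ maximalIdeal A) (p := p)) x

/-- In the perfection, the `p ^ m`-th power of the `m`-th component is the zeroth; if the latter
vanishes, so do all. -/
theorem isUnit_of_mem_teichmullerReps {t : A} (ht : t ∈ teichmullerReps p A) (h0 : t ≠ 0) :
    IsUnit t := by
  obtain ⟨x, rfl⟩ := ht
  by_contra hu
  rw [← mem_nonunits_iff, ← mem_maximalIdeal, ← Ideal.Quotient.eq_zero_iff_mem,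
    Perfection.mk_teichmuller₀] at hu
  refine h0 ?_
  have hx : x = 0 := by
    refine Perfection.ext fun m => ?_
    have := Perfection.coeffMonoidHom_pow_p_pow_self x m
    simp only [Perfection.coeffMonoidHom_eq_coeff] at this
    rw [hu] at this
    rw [map_zero]
    exact pow_eq_zero_iff (pow_ne_zero m (Fact.out : p.Prime).ne_zero) |>.1 this
  rw [hx, map_zero]

theorem exists_mem_teichmullerReps_sub_mem [PerfectRing (A ⧸ maximalIdeal A) p] (a : A) :
    ∃ t ∈ teichmullerReps p A, a - t ∈ maximalIdeal A := by
  obtain ⟨x, hx⟩ := Perfection.coeff_surjective (p := p)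
    (PerfectRing.bijective_frobenius (R := A ⧸ maximalIdeal A) (p := p)).2 0
    (Ideal.Quotient.mk _ a)
  refine ⟨_, ⟨x, rfl⟩, ?_⟩
  rw [← Ideal.Quotient.eq_zero_iff_mem, map_sub, Perfection.mk_teichmuller₀, hx, sub_self]

variable [CommRing B] [IsDomain B] [IsDiscreteValuationRing B] [Algebra A B]
  [PerfectRing (A ⧸ maximalIdeal A) p] {n : ℕ}
  (hr : HasRamification A B n) (hg : IsPowerGenerated A B n)
include hr hg

theorem HasRamification.exists_teichmullerReps_dvd_sub {π : B} (hπ : Irreducible π) (b : B) :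
    ∃ t ∈ teichmullerReps p A, ∃ c, b = algebraMap A B t + π * c := by
  obtain ⟨c, hc⟩ := hg π hπ b
  obtain ⟨t, ht, htc⟩ := exists_mem_teichmullerReps_sub_mem p (c 0)
  have h1 : π ∣ b - algebraMap A B t := by
    obtain ⟨m, rfl⟩ := Nat.exists_eq_succ_of_ne_zero hr.1
    rw [hc, Finset.sum_range_succ', pow_zero, mul_one, add_sub_assoc, ← map_sub]
    refine dvd_add (Finset.dvd_sum fun i _ => ?_)
      ((dvd_pow_self π hr.1).trans (hr.pow_dvd_of_mem hπ htc))
    exact Dvd.dvd.mul_left (dvd_pow_self π i.succ_ne_zero) _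
  obtain ⟨d, hd⟩ := h1
  exact ⟨t, ht, d, by rw [← hd]; ring⟩

/-- `A` and `B` have the same residue field, so subtracting a representative and dividing by `π` can
be iterated. -/
theorem HasRamification.exists_teichmuller_expansion {π : B} (hπ : Irreducible π) (b : B) :
    ∃ f : A⟦X⟧, (∀ i, coeff i f ∈ teichmullerReps p A) ∧ IsAdicSum (maximalIdeal B) f π b := by
  choose t ht r hrr using hr.exists_teichmullerReps_dvd_sub p hg hπ
  refine ⟨PowerSeries.mk fun i => t (r^[i] b), fun i => by simpa using ht _, fun N =>
    ⟨N, fun M hM => ?_⟩⟩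
  have key : ∀ M : ℕ, b =
      (∑ i ∈ Finset.range M, algebraMap A B (t (r^[i] b)) * π ^ i) + π ^ M * r^[M] b := by
    intro M
    induction M with
    | zero => simp
    | succ M ih =>
      rw [Finset.sum_range_succ, Function.iterate_succ_apply', add_assoc]
      conv_lhs => rw [ih]
      conv_lhs => rw [hrr (r^[M] b)]
      ring
  rw [mem_maximalIdeal_pow_iff_dvd hπ]
  have h1 : (∑ i ∈ Finset.range M, coeff i (PowerSeries.mk fun i => t (r^[i] b)) • π ^ i) - b =
      -(π ^ M * r^[M] b) := by
    simp only [coeff_mk, Algebra.smul_def]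
    linear_combination -(key M)
  rw [h1, dvd_neg]
  exact Dvd.dvd.mul_right (pow_dvd_pow _ hM) _

theorem HasRamification.teichmullerSeries_spec {π : B} (hπ : Irreducible π) {πK : A}
    (hπK : Irreducible πK) :
    (∀ i, coeff i (teichmullerSeries p n πK π) ∈ teichmullerReps p A) ∧
      X ^ n ∣ teichmullerSeries p n πK π ∧
      IsAdicSum (maximalIdeal B) (teichmullerSeries p n πK π) π (algebraMap A B πK) := by
  refine Classical.epsilon_spec (p := fun f : A⟦X⟧ =>
    (∀ i, PowerSeries.coeff i f ∈ teichmullerReps p A) ∧ (X : A⟦X⟧) ^ n ∣ f ∧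
      IsAdicSum (maximalIdeal B) f π (algebraMap A B πK)) ?_
  obtain ⟨b, hb⟩ := (hr.associated hπK hπ).symm.dvd
  obtain ⟨f, hf, hfb⟩ := hr.exists_teichmuller_expansion p hg hπ b
  refine ⟨X ^ n * f, fun i => ?_, dvd_mul_right _ _, ?_⟩
  · rw [coeff_X_pow_mul']
    split_ifs
    · exact hf _
    · exact zero_mem_teichmullerReps p
  · have := hfb.polynomial_mul (Polynomial.X ^ n)
    simpa [hb] using this

theorem HasRamification.coeff_teichmullerSeries_ne_zero {π : B} (hπ : Irreducible π) {πK : A}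
    (hπK : Irreducible πK) : coeff n (teichmullerSeries p n πK π) ≠ 0 := by
  obtain ⟨-, h1, h2⟩ := hr.teichmullerSeries_spec p hg hπ hπK
  intro h0
  obtain ⟨M, hM⟩ := h2 (n + 1)
  have h3 := (mem_maximalIdeal_pow_iff_dvd hπ _ _).1 (hM M le_rfl)
  have h4 : π ^ (n + 1) ∣ algebraMap A B πK := by
    refine (dvd_sub_right (Finset.dvd_sum fun i _ => ?_)).1 h3
    rw [Algebra.smul_def]
    rcases lt_or_ge n i with h | h
    · exact Dvd.dvd.mul_left (pow_dvd_pow _ h) _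
    · rcases h.lt_or_eq with h | rfl
      · simp [X_pow_dvd_iff.1 h1 i h]
      · simp [h0]
  have h5 := h4.trans (hr.associated hπK hπ).dvd
  exact absurd ((pow_dvd_pow_iff hπ.ne_zero hπ.not_isUnit).1 h5) (by omega)

/-- Otherwise the series involves only powers of `X ^ p`, and its coefficients are `p`-th powers, so
`πK = z ^ p` in `B`. Separability puts `z` in `K`, and integral closedness puts it in `A`, against
the irreducibility of `πK`. -/
theorem HasRamification.exists_coeff_ne_zero_of_separable {K L : Type*}
    [Field K] [Algebra A K] [IsFractionRing A K]
    [Field L] [Algebra K L] [Algebra.IsSeparable K L]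
    [Algebra B L] [IsFractionRing B L]
    [Algebra A L] [IsScalarTower A K L] [IsScalarTower A B L]
    (hp : (p : B) = 0) {π : B} (hπ : Irreducible π) {πK : A} (hπK : Irreducible πK) :
    ∃ m, ¬ p ∣ m ∧ coeff m (teichmullerSeries p n πK π) ≠ 0 := by
  have hpp : p.Prime := Fact.out
  obtain ⟨h1, -, h2⟩ := hr.teichmullerSeries_spec p hg hπ hπK
  by_contra! hcon
  choose b hb using fun i => exists_pow_eq_of_mem_teichmullerReps p (h1 i)
  have hpre := hr.isPrecomplete hg
  obtain ⟨z, hz⟩ := exists_isAdicSum ((mem_maximalIdeal π).2 hπ.not_isUnit)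
    (PowerSeries.mk fun k => b (p * k))
  have : CharP B p := charP_of_prime_of_natCast_eq_zero hpp hp
  have hzp : z ^ p = algebraMap A B πK := by
    refine sub_eq_zero.1 (eq_zero_of_forall_mem_maximalIdeal_pow _ fun N => ?_)
    obtain ⟨M, hM⟩ := hz N
    obtain ⟨M', hM'⟩ := h2 N
    have h3 := hM (max M M') (le_max_left _ _)
    have h4 := hM' (p * max M M') ((le_max_right _ _).trans
      (Nat.le_mul_of_pos_left _ hpp.pos))
    have h5 : ∑ i ∈ Finset.range (p * max M M'), coeff i (teichmullerSeries p n πK π) • π ^ i =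
        (∑ i ∈ Finset.range (max M M'),
          coeff i (PowerSeries.mk fun k => b (p * k)) • π ^ i) ^ p := by
      rw [sum_pow_char]
      refine (Finset.sum_of_injOn (fun k => p * k) (fun a _ b _ h =>
        Nat.eq_of_mul_eq_mul_left hpp.pos h) (fun k hk => ?_) (fun i hi hni => ?_)
        (fun k _ => ?_)).symm
      · simp only [Finset.coe_range, Set.mem_Iio] at hk ⊢
        exact Nat.mul_lt_mul_of_pos_left hk hpp.pos
      · rw [hcon i, zero_smul]
        rintro ⟨k, rfl⟩
        refine hni ⟨k, ?_, rfl⟩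
        simpa [hpp.pos] using hi
      · rw [coeff_mk, ← hb, Algebra.smul_def, Algebra.smul_def, mul_pow, map_pow, ← pow_mul,
          mul_comm k p]
    rw [h5] at h4
    have h6 := Ideal.mul_mem_left (maximalIdeal B ^ N) (((∑ i ∈ Finset.range (max M M'),
      coeff i (PowerSeries.mk fun k => b (p * k)) • π ^ i) - z) ^ (p - 1)) h3
    rw [← pow_succ, Nat.sub_add_cancel hpp.one_le, sub_pow_char] at h6
    simpa using (maximalIdeal B ^ N).sub_mem h4 h6
  have hinj : Function.Injective (algebraMap A K) := IsFractionRing.injective A K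
  have hpA : (p : A) = 0 := hr.injective (by simp)
  have : CharP K p := charP_of_prime_of_natCast_eq_zero hpp
    (by rw [← map_natCast (algebraMap A K), hpA, map_zero])
  have hexp : ExpChar K p := ExpChar.prime hpp
  have hmem : algebraMap B L z ∈ perfectClosure K L := by
    rw [mem_perfectClosure_iff_pow_mem p]
    refine ⟨1, algebraMap A K πK, ?_⟩
    rw [pow_one, ← map_pow, hzp, ← IsScalarTower.algebraMap_apply,
      ← IsScalarTower.algebraMap_apply]
  rw [perfectClosure.eq_bot_of_isSeparable, IntermediateField.mem_bot] at hmem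
  obtain ⟨y, hy⟩ := hmem
  have hyp : y ^ p = algebraMap A K πK := by
    apply (algebraMap K L).injective
    rw [map_pow, hy, ← map_pow, hzp, ← IsScalarTower.algebraMap_apply,
      ← IsScalarTower.algebraMap_apply]
  obtain ⟨w, hw⟩ := IsIntegrallyClosed.exists_algebraMap_eq_of_isIntegral_pow (R := A) (x := y)
    hpp.pos (hyp ▸ isIntegral_algebraMap)
  rw [← hw, ← map_pow] at hyp
  have h7 := hinj hyp
  rw [← h7] at hπK
  exact not_irreducible_pow hpp.ne_one hπK

end Teichmuller

/-! ### Valuations of binomial coefficients. -/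

section Binomial

variable {p : ℕ} [Fact p.Prime]

theorem padicValNat_le_padicValNat_choose_add {m i : ℕ} (hi : 1 ≤ i) (him : i ≤ m) :
    padicValNat p m ≤ padicValNat p (m.choose i) + padicValNat p i := by
  have h1 := Nat.add_one_mul_choose_eq (m - 1) (i - 1)
  rw [Nat.sub_add_cancel (hi.trans him), Nat.sub_add_cancel hi] at h1
  have h2 := congrArg (padicValNat p) h1
  have h3 : (m - 1).choose (i - 1) ≠ 0 := (Nat.choose_pos (by omega)).ne'
  rw [padicValNat.mul (by omega) h3, padicValNat.mul (Nat.choose_pos him).ne' (by omega)] at h2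
  omega

/-- Kummer's theorem: a carry at position `i` requires `i > j` and makes `m % p ^ i` smaller than `p
^ j`; being divisible by `p ^ j`, it is zero. With the preceding bound this is an equality. -/
theorem padicValNat_choose_prime_pow_add_le {m j : ℕ} (hm : m ≠ 0) (hj : p ^ j ∣ m) :
    padicValNat p (m.choose (p ^ j)) + j ≤ padicValNat p m := by
  have hp : p.Prime := Fact.out
  have hjs : j ≤ padicValNat p m := (padicValNat_dvd_iff_le hm).1 hj
  rw [padicValNat_choose (Nat.le_of_dvd (Nat.pos_of_ne_zero hm) hj) (Nat.lt_succ_self _)]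
  have h1 : {i ∈ Finset.Ico 1 (Nat.log p m).succ |
      p ^ i ≤ p ^ j % p ^ i + (m - p ^ j) % p ^ i} ⊆ Finset.Ioc j (padicValNat p m) := by
    intro i hi
    rw [Finset.mem_filter] at hi
    have hi2 := hi.2
    have hpos : 0 < p ^ i := pow_pos hp.pos i
    have hlt := Nat.mod_lt (m - p ^ j) hpos
    rw [Finset.mem_Ioc]
    have hij : j < i := by
      by_contra hij
      rw [Nat.mod_eq_zero_of_dvd (pow_dvd_pow p (not_lt.1 hij))] at hi2
      omega
    refine ⟨hij, (padicValNat_dvd_iff_le hm).1 ?_⟩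
    rw [Nat.mod_eq_of_lt (Nat.pow_lt_pow_right hp.one_lt hij)] at hi2
    have hqm : p ^ j ≤ m := Nat.le_of_dvd (Nat.pos_of_ne_zero hm) hj
    have h2 : m % p ^ i = p ^ j + (m - p ^ j) % p ^ i - p ^ i := by
      conv_lhs => rw [← Nat.add_sub_cancel' hqm, ← Nat.add_mod_mod, Nat.mod_eq_sub_mod hi2]
      exact Nat.mod_eq_of_lt (by
        have := Nat.pow_lt_pow_right hp.one_lt hij
        omega)
    have h3 : p ^ j ∣ m % p ^ i := (Nat.dvd_mod_iff (pow_dvd_pow p hij.le)).2 hj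
    have h4 : m % p ^ i = 0 := by
      refine Nat.eq_zero_of_dvd_of_lt h3 ?_
      have := pow_pos hp.pos j
      omega
    exact Nat.dvd_of_mod_eq_zero h4
  have h2 := Finset.card_le_card h1
  rw [Nat.card_Ioc] at h2
  omega

/-- If `p ^ ν` divides `e`, two indices with the same shifted value have the same valuation. -/
theorem padicValNat_le_of_add_mul_eq {ν e m m' a b : ℕ} (hm : m ≠ 0) (he : p ^ ν ∣ e)
    (hb : b ≤ padicValNat p m') (hbν : b ≤ ν) (h : m = m' + a * e) : b ≤ padicValNat p m := by
  rw [← padicValNat_dvd_iff_le hm, h]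
  refine dvd_add ?_ (Dvd.dvd.mul_left ((pow_dvd_pow p hbν).trans he) _)
  exact (pow_dvd_pow p hb).trans pow_padicValNat_dvd

end Binomial

/-! ### The recursion for the indices of inseparability, unrolled. -/

section Indices

variable (p : ℕ) [Fact p.Prime]
  {A B : Type*} [CommRing A] [IsDomain A] [IsDiscreteValuationRing A]
  [IsAdicComplete (maximalIdeal A) A] [CharP (A ⧸ maximalIdeal A) p]
  [CommRing B] [IsDomain B] [IsDiscreteValuationRing B] [Algebra A B]
  (n : ℕ) (πK : A) (πL : B)

theorem insepIndex_top :
    insepIndex p n πK πL (padicValNat p n) = preIndex p n πK πL (padicValNat p n) := by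
  rw [insepIndex, Nat.sub_self, indexAux]

theorem insepIndex_of_lt {j : ℕ} (hj : j < padicValNat p n) :
    insepIndex p n πK πL j = min (preIndex p n πK πL j)
      (insepIndex p n πK πL (j + 1) + addVal B (p : B)) := by
  obtain ⟨k, hk⟩ : ∃ k, padicValNat p n - j = k + 1 := ⟨padicValNat p n - j - 1, by omega⟩
  rw [insepIndex, insepIndex, hk, indexAux]
  congr 3 <;> omega

variable {n}

/-- Together with `exists_insepIndex_eq`: `i_j` is the minimum of `ĩ_s + (s - j) v_L(p)` over `j ≤ s
≤ ν`. -/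
theorem insepIndex_le {j s : ℕ} (hjs : j ≤ s) (hs : s ≤ padicValNat p n) :
    insepIndex p n πK πL j ≤ preIndex p n πK πL s + (s - j : ℕ) * addVal B (p : B) := by
  induction hjs using Nat.decreasingInduction with
  | self =>
    rcases hs.lt_or_eq with h | rfl
    · rw [insepIndex_of_lt p n πK πL h]
      simp
    · simp [insepIndex_top]
  | of_succ k hk ih =>
    rw [insepIndex_of_lt p n πK πL (hk.trans_le hs)]
    refine (min_le_right _ _).trans ((add_le_add_left ih _).trans_eq ?_)
    rw [show s - k = (s - (k + 1)) + 1 by omega]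
    push_cast
    ring

theorem exists_insepIndex_eq {j : ℕ} (hj : j ≤ padicValNat p n) :
    ∃ s, j ≤ s ∧ s ≤ padicValNat p n ∧ insepIndex p n πK πL j =
      preIndex p n πK πL s + (s - j : ℕ) * addVal B (p : B) := by
  induction hj using Nat.decreasingInduction with
  | self => exact ⟨_, le_rfl, le_rfl, by simp [insepIndex_top]⟩
  | of_succ k hk ih =>
    rw [insepIndex_of_lt p n πK πL hk]
    rcases min_choice (preIndex p n πK πL k)
      (insepIndex p n πK πL (k + 1) + addVal B (p : B)) with h | h
    · exact ⟨k, le_rfl, hk.le, by simp [h]⟩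
    · obtain ⟨s, hs, hsν, hss⟩ := ih
      refine ⟨s, by omega, hsν, ?_⟩
      rw [h, hss, show s - k = (s - (k + 1)) + 1 by omega]
      push_cast
      ring

variable {πK πL}

theorem preIndex_le {h s : ℕ} (hs : padicValNat p (h + n) ≤ s)
    (h0 : coeff (h + n) (teichmullerSeries p n πK πL) ≠ 0) : preIndex p n πK πL s ≤ h :=
  iInf₂_le h ⟨hs, h0⟩

theorem exists_preIndex_eq {s : ℕ} (hs : preIndex p n πK πL s ≠ ⊤) :
    ∃ h : ℕ, padicValNat p (h + n) ≤ s ∧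
      coeff (h + n) (teichmullerSeries p n πK πL) ≠ 0 ∧ preIndex p n πK πL s = h := by
  rw [preIndex, iInf_subtype'] at hs ⊢
  rcases isEmpty_or_nonempty {h : ℕ // padicValNat p (h + n) ≤ s ∧
    coeff (h + n) (teichmullerSeries p n πK πL) ≠ 0} with he | he
  · exact absurd (iInf_of_empty _) hs
  · obtain ⟨h, hh⟩ := ENat.exists_eq_iInf (fun h : {h : ℕ // padicValNat p (h + n) ≤ s ∧
      coeff (h + n) (teichmullerSeries p n πK πL) ≠ 0} => ((h : ℕ) : ℕ∞))
    exact ⟨h, h.2.1, h.2.2, hh.symm⟩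

/-- The valuation of the `m`-th term of the coefficient of `ε ^ i` in `F^*` is at least the index
of inseparability with index `v_p(i)`. -/
theorem insepIndex_le_choose (h0 : coeff n (teichmullerSeries p n πK πL) ≠ 0) {m i : ℕ}
    (hnm : n ≤ m) (hm : coeff m (teichmullerSeries p n πK πL) ≠ 0) (hi : 1 ≤ i) (him : i ≤ m)
    (hiν : padicValNat p i ≤ padicValNat p n) :
    insepIndex p n πK πL (padicValNat p i) ≤
      (padicValNat p (m.choose i) : ℕ∞) * addVal B (p : B) + (m - n : ℕ) := by
  have h1 := padicValNat_le_padicValNat_choose_add (p := p) hi him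
  obtain ⟨h, rfl⟩ : ∃ h, m = h + n := ⟨m - n, by omega⟩
  rw [Nat.add_sub_cancel, add_comm]
  -- The bound for `i_j` is used at `s = v_p(m)` clamped to the interval from `v_p(i)` to `ν`; at
  -- the upper end `ĩ_ν = 0`, because `a_0 ≠ 0`.
  rcases le_total (padicValNat p (h + n)) (padicValNat p i) with h2 | h2
  · refine (insepIndex_le p πK πL le_rfl hiν).trans ?_
    rw [Nat.sub_self, Nat.cast_zero, zero_mul, add_zero]
    exact (preIndex_le p h2 hm).trans le_self_add
  · rcases le_total (padicValNat p (h + n)) (padicValNat p n) with h3 | h3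
    · refine (insepIndex_le p πK πL h2 h3).trans ?_
      gcongr
      · exact preIndex_le p le_rfl hm
      · omega
    · refine (insepIndex_le p πK πL hiν le_rfl).trans ?_
      gcongr
      · exact (preIndex_le p (h := 0) (by simp) (by simpa using h0)).trans (by simp)
      · omega

end Indices

/-! ### Valuations of the coefficients of `F^*` for the Teichmüller series. -/

section Valuation

variable (p : ℕ) [Fact p.Prime]
  {A B : Type*} [CommRing A] [IsDomain A] [IsDiscreteValuationRing A]
  [CharP (A ⧸ maximalIdeal A) p]
  [CommRing B] [IsDomain B] [IsDiscreteValuationRing B] [Algebra A B]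

variable (A) in
omit [Fact p.Prime] in
theorem natCast_mem_maximalIdeal : (p : A) ∈ maximalIdeal A := by
  rw [← Ideal.Quotient.eq_zero_iff_mem, map_natCast, CharP.cast_eq_zero]

/-- Integers prime to `p` are units already in `A`. The formula covers `p = 0` in `B` through `0 * ⊤
= 0`. -/
theorem addVal_natCast (A B : Type*) [CommRing A] [IsDomain A] [IsDiscreteValuationRing A]
    [CharP (A ⧸ maximalIdeal A) p] [CommRing B] [IsDomain B] [IsDiscreteValuationRing B]
    [Algebra A B] {k : ℕ} (hk : k ≠ 0) :
    addVal B (k : B) = (padicValNat p k : ℕ∞) * addVal B (p : B) := by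
  obtain ⟨c, hc⟩ := pow_padicValNat_dvd (p := p) (n := k)
  have hpc : ¬ p ∣ c := fun h => by
    refine pow_succ_padicValNat_not_dvd (p := p) hk ?_
    rw [pow_succ]
    conv_rhs => rw [hc]
    exact mul_dvd_mul_left _ h
  have hu : IsUnit (c : A) := by
    by_contra h
    rw [← mem_nonunits_iff, ← mem_maximalIdeal, ← Ideal.Quotient.eq_zero_iff_mem, map_natCast,
      CharP.cast_eq_zero_iff _ p] at h
    exact hpc h
  have hu' : addVal B (c : B) = 0 := by
    rw [IsDiscreteValuationRing.addVal_eq_zero_iff, ← map_natCast (algebraMap A B)]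
    exact hu.map _
  conv_lhs => rw [hc]
  rw [Nat.cast_mul, IsDiscreteValuationRing.addVal_mul, hu', add_zero, Nat.cast_pow,
    IsDiscreteValuationRing.addVal_pow, nsmul_eq_mul]

omit [Fact p.Prime] in
theorem HasRamification.dvd_of_addVal_natCast {n : ℕ} (hr : HasRamification A B n) {e : ℕ}
    (he : addVal B (p : B) = e) : n ∣ e ∧ e ≠ 0 := by
  have h1 := hr.2 (p : A)
  rw [map_natCast, he] at h1
  obtain ⟨π, hπ⟩ := IsDiscreteValuationRing.exists_irreducible A
  have h2 := (pow_dvd_iff_le_addVal hπ 1 (p : A)).1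
    (by simpa using (mem_maximalIdeal_iff_dvd hπ _).1 (natCast_mem_maximalIdeal p A))
  have h3 : addVal A (p : A) ≠ ⊤ := fun h => by
    rw [h, ENat.mul_top (by exact_mod_cast hr.1)] at h1
    exact ENat.natCast_ne_top e h1
  obtain ⟨q, hq⟩ := ENat.ne_top_iff_exists.1 h3
  rw [← hq] at h1 h2
  have h4 : e = n * q := by exact_mod_cast h1
  have h5 : 1 ≤ q := by exact_mod_cast h2
  exact ⟨⟨q, h4⟩, by rw [h4]; exact Nat.mul_ne_zero hr.1 (by omega)⟩

variable [IsAdicComplete (maximalIdeal A) A]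

theorem addVal_term {a : A} (ha : a ∈ teichmullerReps p A) (ha0 : a ≠ 0) {π : B}
    (hπ : Irreducible π) {m i : ℕ} (him : i ≤ m) :
    addVal B (algebraMap A B a * (m.choose i * π ^ m)) =
      (padicValNat p (m.choose i) : ℕ∞) * addVal B (p : B) + m := by
  have hu : addVal B (algebraMap A B a) = 0 :=
    IsDiscreteValuationRing.addVal_eq_zero_iff.2
      ((isUnit_of_mem_teichmullerReps p ha ha0).map _)
  rw [IsDiscreteValuationRing.addVal_mul, IsDiscreteValuationRing.addVal_mul, hu, zero_add,
    hπ.addVal_pow, addVal_natCast p A B (Nat.choose_pos him).ne']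

variable [PerfectRing (A ⧸ maximalIdeal A) p] {n : ℕ}
  (hr : HasRamification A B n) (hg : IsPowerGenerated A B n) {π : B} (hπ : Irreducible π)
  {πK : A} (hπK : Irreducible πK)
include hr hg hπ hπK

theorem HasRamification.exists_dvd_sum_sub_starSeries {i : ℕ} (hi : 1 ≤ i) (N : ℕ) :
    ∃ M₀ : ℕ, ∀ M ≥ M₀, π ^ N ∣ (∑ m ∈ Finset.range M,
      algebraMap A B (coeff m (teichmullerSeries p n πK π)) * (m.choose i * π ^ m)) -
        algebraMap A B πK * coeff i (starSeries πK π (teichmullerSeries p n πK π)) := by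
  obtain ⟨-, h1, h2⟩ := hr.teichmullerSeries_spec p hg hπ hπK
  have h3 := (hr.starSeries_spec hg hπ hπK h1 h2).exists_dvd_coeff hπ i N
  have hi0 : i ≠ 0 := by omega
  simpa [coeff_C, if_neg hi0] using h3

theorem HasRamification.insepIndex_le_addVal {i : ℕ} (hi : 1 ≤ i)
    (hiν : padicValNat p i ≤ padicValNat p n) :
    insepIndex p n πK π (padicValNat p i) ≤
      addVal B (coeff i (starSeries πK π (teichmullerSeries p n πK π))) := by
  obtain ⟨h1, h2, -⟩ := hr.teichmullerSeries_spec p hg hπ hπK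
  have h0 := hr.coeff_teichmullerSeries_ne_zero p hg hπ hπK
  rw [← ENat.add_le_add_iff_left (ENat.natCast_ne_top n)]
  conv_rhs => rw [← hr.addVal_uniformizer hπK, ← IsDiscreteValuationRing.addVal_mul]
  rw [← ENat.forall_natCast_le_iff_le]
  -- A finite bound `N` is tested because the coefficient is known only as a limit of finite sums
  -- modulo `π ^ N`.
  intro N hN
  rw [← pow_dvd_iff_le_addVal hπ]
  obtain ⟨M, hM⟩ := hr.exists_dvd_sum_sub_starSeries p hg hπ hπK hi N
  refine (dvd_sub_right (Finset.dvd_sum fun m _ => ?_)).1 (hM M le_rfl)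
  by_cases hm : coeff m (teichmullerSeries p n πK π) = 0
  · simp [hm]
  by_cases him : i ≤ m
  · have hnm : n ≤ m := by
      by_contra hnm
      exact hm (X_pow_dvd_iff.1 h2 m (not_le.1 hnm))
    rw [pow_dvd_iff_le_addVal hπ, addVal_term p (h1 m) hm hπ him]
    refine hN.trans ((add_le_add_right
      (insepIndex_le_choose p h0 hnm hm hi him hiν) _).trans_eq ?_)
    obtain ⟨h, rfl⟩ := Nat.exists_eq_add_of_le hnm
    rw [Nat.add_sub_cancel_left]
    push_cast
    ring
  · simp [Nat.choose_eq_zero_of_lt (not_le.1 him)]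

/-- At most one term of the coefficient of `ε ^ (p ^ j)` has the least possible valuation. -/
theorem HasRamification.eq_of_choose_eq {j w m m' : ℕ} (hm0 : m ≠ 0) (hm0' : m' ≠ 0)
    (hj : j ≤ padicValNat p n) (hw : insepIndex p n πK π j = w)
    (hjm : j ≤ padicValNat p m) (hjm' : j ≤ padicValNat p m')
    (hmν : padicValNat p m ≤ padicValNat p n)
    (hm : ((padicValNat p m - j : ℕ) : ℕ∞) * addVal B (p : B) + m = w + n)
    (hm' : ((padicValNat p m' - j : ℕ) : ℕ∞) * addVal B (p : B) + m' = w + n)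
    (hnm' : n ≤ m') : m' = m := by
  -- If `p = 0` in `B`, a finite value forces the multiple of `v_L(p)` to vanish, leaving the index
  -- equal to `w + n`.
  by_cases he : addVal B (p : B) = ⊤
  · have key : ∀ k : ℕ, j ≤ padicValNat p k →
        ((padicValNat p k - j : ℕ) : ℕ∞) * addVal B (p : B) + k = w + n → k = w + n := by
      intro k hk h
      rcases Nat.eq_zero_or_pos (padicValNat p k - j) with h0 | h0
      · rw [h0, Nat.cast_zero, zero_mul, zero_add] at h
        exact_mod_cast h
      · rw [he, ENat.mul_top (by exact_mod_cast h0.ne'), top_add] at h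
        exact absurd h.symm (ENat.natCast_ne_top (w + n))
    rw [key m hjm hm, key m' hjm' hm']
  · obtain ⟨e, he⟩ := ENat.ne_top_iff_exists.1 he
    obtain ⟨hne, he0⟩ := hr.dvd_of_addVal_natCast p he.symm
    have hpe : p ^ padicValNat p n ∣ e := pow_padicValNat_dvd.trans hne
    have hwν : w ≤ (padicValNat p n - j) * e := by
      have h0 := hr.coeff_teichmullerSeries_ne_zero p hg hπ hπK
      have h1 := insepIndex_le p πK π hj le_rfl
      rw [hw, ← he] at h1
      have h2 := preIndex_le p (πL := π) (n := n) (h := 0) (s := padicValNat p n) (by simp)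
        (by simpa using h0)
      have h3 := h1.trans (add_le_add_left h2 _)
      simp only [Nat.cast_zero, zero_add] at h3
      exact_mod_cast h3
    rw [← he] at hm hm'
    have hm : (padicValNat p m - j) * e + m = w + n := by exact_mod_cast hm
    have hm' : (padicValNat p m' - j) * e + m' = w + n := by exact_mod_cast hm'
    -- Otherwise the value would be at least `(ν - j + 1) e + n`, which exceeds `w + n`.
    have hmν' : padicValNat p m' ≤ padicValNat p n := by
      by_contra hcon
      have : (padicValNat p n - j + 1) * e ≤ (padicValNat p m' - j) * e :=
        Nat.mul_le_mul_right e (by omega)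
      rw [add_one_mul] at this
      omega
    -- `m` and `m'` differ by a multiple of `e`, hence of `p ^ ν`, so neither can have the larger
    -- `p`-adic valuation.
    rcases lt_trichotomy (padicValNat p m) (padicValNat p m') with h | h | h
    · have : m = m' + (padicValNat p m' - padicValNat p m) * e := by
        have h1 : padicValNat p m' - j =
          (padicValNat p m' - padicValNat p m) + (padicValNat p m - j) := by omega
        rw [h1, add_mul] at hm'
        omega
      have := padicValNat_le_of_add_mul_eq hm0 hpe le_rfl hmν' this
      omega
    · rw [h] at hm
      omega
    · have : m' = m + (padicValNat p m - padicValNat p m') * e := by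
        have h1 : padicValNat p m - j =
          (padicValNat p m - padicValNat p m') + (padicValNat p m' - j) := by omega
        rw [h1, add_mul] at hm
        omega
      have := padicValNat_le_of_add_mul_eq hm0' hpe le_rfl hmν this
      omega

/-- Under `H`, every index that could attain `i_j` is divisible by `p ^ j`, so the binomial
coefficient has valuation exactly `v_p(m) - j`; the minimal term is then unique and cannot cancel.
-/
theorem HasRamification.addVal_le_insepIndex_of_forall {j : ℕ} (hj : j ≤ padicValNat p n)
    (H : ∀ m, n ≤ m → coeff m (teichmullerSeries p n πK π) ≠ 0 →
      ((m - n : ℕ) : ℕ∞) ≤ insepIndex p n πK π j → j ≤ padicValNat p m) :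
    addVal B (coeff (p ^ j) (starSeries πK π (teichmullerSeries p n πK π))) ≤
      insepIndex p n πK π j := by
  have hp : p.Prime := Fact.out
  by_cases htop : insepIndex p n πK π j = ⊤
  · rw [htop]
    exact le_top
  obtain ⟨w, hw⟩ := ENat.ne_top_iff_exists.1 htop
  obtain ⟨h1, h2, -⟩ := hr.teichmullerSeries_spec p hg hπ hπK
  have h0 := hr.coeff_teichmullerSeries_ne_zero p hg hπ hπK
  have hvp : padicValNat p (p ^ j) = j := padicValNat.prime_pow j
  have hval : ∀ m, m ≠ 0 → j ≤ padicValNat p m →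
      p ^ j ≤ m ∧ padicValNat p (m.choose (p ^ j)) = padicValNat p m - j := fun m hm hjm => by
    have hd : p ^ j ∣ m := (padicValNat_dvd_iff_le hm).2 hjm
    have hle := Nat.le_of_dvd (Nat.pos_of_ne_zero hm) hd
    have h3 := padicValNat_choose_prime_pow_add_le hm hd
    have h4 := padicValNat_le_padicValNat_choose_add (p := p) (Nat.one_le_pow j p hp.pos) hle
    rw [hvp] at h4
    exact ⟨hle, by omega⟩
  obtain ⟨m, hnm, hm, hjm, hmν, hmw⟩ : ∃ m, n ≤ m ∧
      coeff m (teichmullerSeries p n πK π) ≠ 0 ∧ j ≤ padicValNat p m ∧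
      padicValNat p m ≤ padicValNat p n ∧
      ((padicValNat p m - j : ℕ) : ℕ∞) * addVal B (p : B) + m = w + n := by
    obtain ⟨s, hjs, hsν, hs⟩ := exists_insepIndex_eq p πK π hj
    have hpre : preIndex p n πK π s ≠ ⊤ := fun h => by
      rw [h, top_add] at hs
      exact htop hs
    obtain ⟨h, hhs, hh0, hh⟩ := exists_preIndex_eq p hpre
    rw [hh] at hs
    have hjm := H (h + n) (Nat.le_add_left n h) hh0 (by
      rw [Nat.add_sub_cancel, hs]
      exact le_self_add)
    refine ⟨h + n, Nat.le_add_left n h, hh0, hjm, hhs.trans hsν, ?_⟩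
    have h3 := (insepIndex_le p πK π hjm (hhs.trans hsν)).trans
      (add_le_add_left (preIndex_le p le_rfl hh0) _)
    have h4 : (h : ℕ∞) + (padicValNat p (h + n) - j : ℕ) * addVal B (p : B) ≤
        insepIndex p n πK π j := by
      rw [hs]
      gcongr
    -- The minimum is attained at level `s ≥ v_p(h + n)`; this squeeze shows it is also attained at
    -- `v_p(h + n)`.
    have h5 := h4.antisymm h3
    rw [← hw] at h5
    rw [← h5]
    push_cast
    ring
  have hn0 : ∀ {k}, n ≤ k → k ≠ 0 := fun hk => ((Nat.pos_of_ne_zero hr.1).trans_le hk).ne'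
  rw [← ENat.add_le_add_iff_left (ENat.natCast_ne_top n)]
  conv_lhs => rw [← hr.addVal_uniformizer hπK, ← IsDiscreteValuationRing.addVal_mul]
  rw [← hw]
  by_contra hcon
  rw [not_le] at hcon
  have hdvd : π ^ (n + w + 1) ∣ algebraMap A B πK *
      coeff (p ^ j) (starSeries πK π (teichmullerSeries p n πK π)) := by
    rw [pow_dvd_iff_le_addVal hπ]
    push_cast
    exact Order.add_one_le_of_lt hcon
  obtain ⟨M, hM⟩ := hr.exists_dvd_sum_sub_starSeries p hg hπ hπK (Nat.one_le_pow j p hp.pos)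
    (n + w + 1)
  -- The maximum with `m + 1` ensures that the minimal term occurs in the partial sum.
  have h3 := (dvd_sub_left hdvd).1 (hM (max M (m + 1)) (le_max_left _ _))
  rw [← Finset.add_sum_erase _ _ (Finset.mem_range.2
    ((Nat.lt_succ_self m).trans_le (le_max_right M (m + 1))))] at h3
  have h4 := (dvd_add_left (Finset.dvd_sum fun m' hm' => ?_)).1 h3
  · rw [pow_dvd_iff_le_addVal hπ, addVal_term p (h1 m) hm hπ (hval m (hn0 hnm) hjm).1,
      (hval m (hn0 hnm) hjm).2, hmw] at h4
    have h5 : n + w + 1 ≤ w + n := by exact_mod_cast h4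
    omega
  · by_cases hm0' : coeff m' (teichmullerSeries p n πK π) = 0
    · simp [hm0']
    by_cases him : p ^ j ≤ m'
    swap
    · simp [Nat.choose_eq_zero_of_lt (not_le.1 him)]
    have hnm' : n ≤ m' := by
      by_contra hnm'
      exact hm0' (X_pow_dvd_iff.1 h2 m' (not_le.1 hnm'))
    rw [pow_dvd_iff_le_addVal hπ, addVal_term p (h1 m') hm0' hπ him]
    have h6 := insepIndex_le_choose p h0 hnm' hm0' (Nat.one_le_pow j p hp.pos) him (by rwa [hvp])
    rw [hvp, ← hw] at h6
    have h7 : (padicValNat p (m'.choose (p ^ j)) : ℕ∞) * addVal B (p : B) + m' =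
        ((padicValNat p (m'.choose (p ^ j)) : ℕ∞) * addVal B (p : B) + (m' - n : ℕ)) + n := by
      rw [add_assoc, ← Nat.cast_add, Nat.sub_add_cancel hnm']
    push_cast
    rw [add_comm (n : ℕ∞), h7]
    have h8 : (w : ℕ∞) ≠
        (padicValNat p (m'.choose (p ^ j)) : ℕ∞) * addVal B (p : B) + (m' - n : ℕ) := by
      intro h8
      have hjm' := H m' hnm' hm0' (by
        rw [← hw, h8]
        exact le_add_self)
      rw [(hval m' (hn0 hnm') hjm').2] at h8 h7
      rw [← h8] at h7
      exact (Finset.mem_erase.1 hm').1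
        (hr.eq_of_choose_eq p hg hπ hπK (hn0 hnm) (hn0 hnm') hj hw.symm hjm hjm' hmν hmw h7 hnm')
    rw [add_right_comm]
    exact add_le_add_left (Order.add_one_le_of_lt (lt_of_le_of_ne h6 h8)) _

/-- If the condition `H` of the preceding lemma fails at `m`, then `s = v_p(m) < j` satisfies `i_s ≤
ĩ_s ≤ m - n ≤ i_j`, and induction applies to `s`. -/
theorem HasRamification.exists_addVal_le_insepIndex {j : ℕ} (hj : j ≤ padicValNat p n) :
    ∃ s ≤ j, addVal B (coeff (p ^ s) (starSeries πK π (teichmullerSeries p n πK π))) ≤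
      insepIndex p n πK π j := by
  induction j using Nat.strong_induction_on with
  | _ j ih =>
    by_cases H : ∀ m, n ≤ m → coeff m (teichmullerSeries p n πK π) ≠ 0 →
      ((m - n : ℕ) : ℕ∞) ≤ insepIndex p n πK π j → j ≤ padicValNat p m
    · exact ⟨j, le_rfl, hr.addVal_le_insepIndex_of_forall p hg hπ hπK hj H⟩
    · push Not at H
      obtain ⟨m, hnm, hm, hmj, hlt⟩ := H
      obtain ⟨s, hs, hs'⟩ := ih _ hlt (hlt.le.trans hj)
      refine ⟨s, hs.trans hlt.le, hs'.trans (le_trans ?_ hmj)⟩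
      refine (insepIndex_le p πK π le_rfl (hlt.le.trans hj)).trans ?_
      rw [Nat.sub_self, Nat.cast_zero, zero_mul, add_zero]
      obtain ⟨h, rfl⟩ : ∃ h, m = h + n := ⟨m - n, by omega⟩
      rw [Nat.add_sub_cancel]
      exact preIndex_le p le_rfl hm

theorem HasRamification.phi_eq_Psi {j : ℕ} (hj : j ≤ padicValNat p n) (x : ℝ≥0) :
    phi p n πK π j x = Psi ((trunc (p ^ (j + 1))
      (starSeries πK π (teichmullerSeries p n πK π)) : Polynomial B) : B⟦X⟧) x := by
  have hp : p.Prime := Fact.out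
  refine le_antisymm (le_iInf₂ fun i hi => ?_) (le_iInf₂ fun j₀ hj₀ => ?_)
  · rw [coeff_trunc_coe]
    split_ifs with hij
    · have hdvd : p ^ padicValNat p i ≤ i := Nat.le_of_dvd hi pow_padicValNat_dvd
      have hlt : padicValNat p i < j + 1 :=
        (Nat.pow_lt_pow_iff_right hp.one_lt).1 (hdvd.trans_lt hij)
      refine (iInf₂_le (padicValNat p i) (Finset.mem_range.2 hlt)).trans ?_
      refine add_le_add ?_ ?_
      · exact_mod_cast hr.insepIndex_le_addVal p hg hπ hπK hi (by omega)
      · gcongr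
        exact_mod_cast hdvd
    · simp
  · rw [Finset.mem_range] at hj₀
    obtain ⟨s, hs, hsv⟩ := hr.exists_addVal_le_insepIndex p hg hπ hπK
      (j := j₀) (by omega)
    refine (iInf₂_le (p ^ s) (Nat.one_le_pow s p hp.pos)).trans ?_
    rw [coeff_trunc_coe, if_pos (Nat.pow_lt_pow_right hp.one_lt (by omega))]
    refine add_le_add (by exact_mod_cast hsv) ?_
    gcongr
    exact_mod_cast Nat.pow_le_pow_right hp.pos hs

theorem HasRamification.insepIndex_zero_ne_top {K L : Type*}
    [Field K] [Algebra A K] [IsFractionRing A K]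
    [Field L] [Algebra K L] [Algebra.IsSeparable K L]
    [Algebra B L] [IsFractionRing B L]
    [Algebra A L] [IsScalarTower A K L] [IsScalarTower A B L] :
    insepIndex p n πK π 0 ≠ ⊤ := by
  rw [← lt_top_iff_ne_top]
  by_cases hp0 : (p : B) = 0
  · obtain ⟨m, hpm, hm⟩ := hr.exists_coeff_ne_zero_of_separable p hg (K := K) (L := L) hp0 hπ hπK
    obtain ⟨-, h2, -⟩ := hr.teichmullerSeries_spec p hg hπ hπK
    have hnm : n ≤ m := by
      by_contra hnm
      exact hm (X_pow_dvd_iff.1 h2 m (not_le.1 hnm))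
    obtain ⟨h, rfl⟩ : ∃ h, m = h + n := ⟨m - n, by omega⟩
    have h1 := insepIndex_le p πK π (le_refl 0) (Nat.zero_le (padicValNat p n))
    have h3 := preIndex_le p (padicValNat.eq_zero_of_not_dvd hpm).le hm
    refine (h1.trans (add_le_add_left h3 _)).trans_lt ?_
    simp
  · have h1 := insepIndex_le p πK π (Nat.zero_le _) (le_refl (padicValNat p n))
    have h2 := preIndex_le p (πL := π) (n := n) (h := 0) (s := padicValNat p n) (by simp)
      (by simpa using hr.coeff_teichmullerSeries_ne_zero p hg hπ hπK)
    refine (h1.trans (add_le_add_left h2 _)).trans_lt ?_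
    obtain ⟨e, he⟩ := ENat.ne_top_iff_exists.1
      (fun h => hp0 (IsDiscreteValuationRing.addVal_eq_top_iff.1 h))
    rw [← he]
    exact_mod_cast ENat.natCast_lt_top _

end Valuation

end HasseHerbrand

/-- `K` is a complete discretely valued field with valuation ring `A` and perfect residue field of
characteristic `p`; `L / K` is a finite separable totally ramified extension, and `B` is the
valuation ring of `L`. The function `φ^j` is computed from uniformizers `ϖK`, `ϖL` which need not
be the uniformizers `πK`, `πL` from which `F^*` is built. -/
theorem mainTheorem3 (p : ℕ) [Fact p.Prime] {A K B L : Type*}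
    [CommRing A] [IsDomain A] [IsDiscreteValuationRing A]
    [IsAdicComplete (maximalIdeal A) A]
    [CharP (A ⧸ maximalIdeal A) p] [PerfectRing (A ⧸ maximalIdeal A) p]
    [Field K] [Algebra A K] [IsFractionRing A K]
    [Field L] [Algebra K L] [FiniteDimensional K L] [Algebra.IsSeparable K L]
    [CommRing B] [IsDomain B] [IsDiscreteValuationRing B] [Algebra B L] [IsFractionRing B L]
    [Algebra A B] [Algebra A L] [IsScalarTower A K L] [IsScalarTower A B L]
    (htr : HasseHerbrand.IsTotallyRamified A K B L)
    (ϖK : A) (ϖL : B) (hϖK : Irreducible ϖK) (hϖL : Irreducible ϖL)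
    (πK : A) (πL : B) (hπK : Irreducible πK) (hπL : Irreducible πL)
    (F : A⟦X⟧) (hF : (PowerSeries.X : A⟦X⟧) ^ Module.finrank K L ∣ F)
    (hFπ : HasseHerbrand.IsAdicSum (maximalIdeal B) F πL (algebraMap A B πK))
    (j : ℕ) (hj : j ≤ padicValNat p (Module.finrank K L)) (x : ℝ≥0) :
    HasseHerbrand.phi p (Module.finrank K L) ϖK ϖL j x ≠ ∞ ∧
    HasseHerbrand.phi p (Module.finrank K L) ϖK ϖL j x =
      HasseHerbrand.Psi
        ((PowerSeries.trunc (p ^ (j + 1)) (HasseHerbrand.starSeries πK πL F) :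
          Polynomial B) : B⟦X⟧) x := by
  have hr : HasseHerbrand.HasRamification A B (Module.finrank K L) :=
    HasseHerbrand.hasRamification_of_irreducible Module.finrank_pos.ne' htr
  have hg : HasseHerbrand.IsPowerGenerated A B (Module.finrank K L) :=
    HasseHerbrand.isPowerGenerated_of_finrank hr
  refine ⟨?_, ?_⟩
  · rw [← lt_top_iff_ne_top]
    refine (iInf₂_le 0 (Finset.mem_range.2 j.succ_pos)).trans_lt ?_
    obtain ⟨i, hi⟩ := ENat.ne_top_iff_exists.1
      (hr.insepIndex_zero_ne_top p hg hϖL hϖK (K := K) (L := L))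
    rw [← hi, pow_zero, one_mul]
    simp
  · rw [hr.phi_eq_Psi p hg hϖL hϖK hj]
    obtain ⟨-, hT, hTϖ⟩ := hr.teichmullerSeries_spec p hg hϖL hϖK
    -- The comparison of coefficient ideals is symmetric in the two sets of data; each direction
    -- yields one inequality.
    exact le_antisymm
      ((hr.coeffDvd_starSeries hg hπL hϖL hπK hϖK hF hT hFπ hTϖ).Psi_trunc_le
        (hr.coeff_zero_starSeries hg hϖL hϖK hT hTϖ) _ x)
      ((hr.coeffDvd_starSeries hg hϖL hπL hϖK hπK hT hF hTϖ hFπ).Psi_trunc_le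
        (hr.coeff_zero_starSeries hg hπL hπK hF hFπ) _ x)
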